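/- Let $A$ be an associative ring with unit. An $A$-coring is an $(A,A)$-bimodule $C$ with $(A,A)$-bimodule maps $\Delta : C \to C\otimes_A C$ (coproduct) and $\varepsilon : C\to A$ (counit) such that $(\Delta\otimes C)\Delta = (C\otimes\Delta)\Delta$ and $(\varepsilon\otimes C)\Delta = \mathrm{id}_C = (C\otimes\varepsilon)\Delta$. Let $\mathbf M_A$ be the category of right $A$-modules and $\mathbf M^C$ the category of right $C$-comodules, i.e. right $A$-modules $M$ with a right $A$-linear coassociative and counital coaction $M\to M\otimes_A C$. Let $C$ be an $A$-coring such that * $C$ is centrally projective: $C\oplus W\cong A^n$ as $(A,A)$-bimodules for some $(A,A)$-bimodule $W$ and some $n\in\mathbb N$; * $C$ is cosplit: the functor $-\otimes_A C : \mathbf M_A\to \mathbf M^C$ (where $M\otimes_A C$ has the coaction $M\otimes\Delta$) is separable. Here a functor $G$ is separable if the natural transformation $\mathrm{Hom}(X,Y)\to\mathrm{Hom}(GX,GY)$, $f\mapsto G(f)$, has a left inverse natural in $X$ and $Y$; * $C$ is coseparable: there is a $(C,C)$-bicomodule map $\pi : C\otimes_A C\to C$ with $\pi\circ\Delta=\mathrm{id}_C$.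 Then $C$ is a Frobenius coring: the forgetful functor $F:\mathbf M^C\to\mathbf M_A$ is a Frobenius functor, i.e. there is a functor $\mathbf M_A\to\mathbf M^C$ that is both a left and a right adjoint of $F$ (equivalently, since $-\otimes_A C$ is always right adjoint to $F$, the functor $-\otimes_A C$ is also left adjoint to $F$). -/

import Mathlib

open CategoryTheory MulOpposite

universe u v w

namespace CoringTheory

/-! ### The tensor product over a noncommutative ring

Right `A`-modules are modules over `Aᵐᵒᵖ`; an `(A, A)`-bimodule carries commuting actions of `A`
and `Aᵐᵒᵖ`. The action `m * a` of `a` on the right is written `op a • m`. -/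

section Tensor

variable (A : Type u) [Ring A]

/-- The relations `m a ⊗ n = m ⊗ a n` in `M ⊗_ℤ N`. -/
def balancing (M : Type v) (N : Type w) [AddCommGroup M] [AddCommGroup N] [Module Aᵐᵒᵖ M]
    [Module A N] : AddSubgroup (TensorProduct ℤ M N) :=
  AddSubgroup.closure
    {x | ∃ (m : M) (a : A) (n : N),
      x = TensorProduct.tmul ℤ (op a • m) n - TensorProduct.tmul ℤ m (a • n)}

/-- The tensor product `M ⊗_A N` of a right `A`-module `M` and a left `A`-module `N`. -/
def Tens (M : Type v) (N : Type w) [AddCommGroup M] [AddCommGroup N] [Module Aᵐᵒᵖ M]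
    [Module A N] : Type (max v w) :=
  TensorProduct ℤ M N ⧸ balancing A M N

end Tensor

namespace Tens

variable {A : Type u} [Ring A]

section Basic

variable {M M' M'' N N' N'' P : Type*} [AddCommGroup M] [AddCommGroup N] [Module Aᵐᵒᵖ M]
  [Module A N] [AddCommGroup M'] [AddCommGroup N'] [Module Aᵐᵒᵖ M'] [Module A N']
  [AddCommGroup M''] [AddCommGroup N''] [Module Aᵐᵒᵖ M''] [Module A N''] [AddCommGroup P]

instance : AddCommGroup (Tens A M N) :=
  inferInstanceAs (AddCommGroup (TensorProduct ℤ M N ⧸ balancing A M N))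

variable (A M N) in
/-- The projection `M ⊗_ℤ N → M ⊗_A N`. -/
def proj : TensorProduct ℤ M N →+ Tens A M N := QuotientAddGroup.mk' (balancing A M N)

variable (A) in
/-- The pure tensor `m ⊗ n` in `M ⊗_A N`. -/
def tmul (m : M) (n : N) : Tens A M N := proj A M N (TensorProduct.tmul ℤ m n)

theorem tmul_add (m : M) (n n' : N) : tmul A m (n + n') = tmul A m n + tmul A m n' := by
  rw [tmul, TensorProduct.tmul_add, map_add]; rfl

theorem add_tmul (m m' : M) (n : N) : tmul A (m + m') n = tmul A m n + tmul A m' n := by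
  rw [tmul, TensorProduct.add_tmul, map_add]; rfl

theorem op_smul_tmul (m : M) (a : A) (n : N) : tmul A (op a • m) n = tmul A m (a • n) := by
  rw [← sub_eq_zero, tmul, tmul, ← map_sub]
  exact (QuotientAddGroup.eq_zero_iff _).2 (AddSubgroup.subset_closure ⟨m, a, n, rfl⟩)

theorem induction {motive : Tens A M N → Prop} (x : Tens A M N)
    (tmul : ∀ m n, motive (tmul A m n)) (add : ∀ x y, motive x → motive y → motive (x + y)) :
    motive x := by
  obtain ⟨y, rfl⟩ := QuotientAddGroup.mk'_surjective (balancing A M N) x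
  induction y using TensorProduct.induction_on with
  | zero =>
    have h := tmul 0 0
    rwa [Tens.tmul, TensorProduct.zero_tmul] at h
  | tmul m n => exact tmul m n
  | add x y hx hy => exact add _ _ hx hy

theorem hom_ext {f g : Tens A M N →+ P} (h : ∀ m n, f (tmul A m n) = g (tmul A m n)) : f = g := by
  ext x
  induction x using Tens.induction with
  | tmul m n => exact h m n
  | add x y hx hy => rw [map_add, map_add, hx, hy]

/-- The additive map out of `M ⊗_A N` given by a biadditive `A`-balanced map. -/
def lift (f : M →+ N →+ P) (hf : ∀ (m : M) (a : A) (n : N), f (op a • m) n = f m (a • n)) : Tens A M N →+ P :=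
  QuotientAddGroup.lift (balancing A M N)
    (TensorProduct.liftAddHom f (fun r m n => by rw [map_zsmul, map_zsmul, AddMonoidHom.zsmul_apply]))
    ((AddSubgroup.closure_le _).2 (by
      rintro _ ⟨m, a, n, rfl⟩
      refine AddMonoidHom.mem_ker.2 ?_
      rw [map_sub]
      exact sub_eq_zero.2 (hf m a n)))

@[simp] theorem lift_tmul (f : M →+ N →+ P) (hf : ∀ (m : M) (a : A) (n : N), f (op a • m) n = f m (a • n))
    (m : M) (n : N) : lift f hf (tmul A m n) = f m n := rfl

/-- A biadditive map written as a function of two variables. -/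
def mkBiadd (f : M → N → P) (h₁ : ∀ m m' n, f (m + m') n = f m n + f m' n)
    (h₂ : ∀ m n n', f m (n + n') = f m n + f m n') : M →+ N →+ P :=
  AddMonoidHom.mk' (fun m => AddMonoidHom.mk' (f m) (h₂ m))
    (fun m m' => AddMonoidHom.ext (h₁ m m'))

@[simp] theorem mkBiadd_apply (f : M → N → P) (h₁ h₂) (m : M) (n : N) :
    mkBiadd f h₁ h₂ m n = f m n := rfl

/-- The map `f ⊗ g : M ⊗_A N → M' ⊗_A N'`, `m ⊗ n ↦ f m ⊗ g n`. -/
def map (f : M →ₗ[Aᵐᵒᵖ] M') (g : N →ₗ[A] N') : Tens A M N →+ Tens A M' N' :=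
  lift (mkBiadd (fun m n => tmul A (f m) (g n))
    (fun m m' n => by simp only [map_add, add_tmul])
    (fun m n n' => by simp only [map_add, tmul_add]))
    (fun m a n => by simp only [mkBiadd_apply, map_smul, op_smul_tmul])

@[simp] theorem map_tmul (f : M →ₗ[Aᵐᵒᵖ] M') (g : N →ₗ[A] N') (m : M) (n : N) :
    map f g (tmul A m n) = tmul A (f m) (g n) := rfl

theorem map_id : map (LinearMap.id : M →ₗ[Aᵐᵒᵖ] M) (LinearMap.id : N →ₗ[A] N) =
    AddMonoidHom.id (Tens A M N) :=
  hom_ext fun _ _ => rfl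

theorem map_map (f' : M' →ₗ[Aᵐᵒᵖ] M'') (g' : N' →ₗ[A] N'') (f : M →ₗ[Aᵐᵒᵖ] M')
    (g : N →ₗ[A] N') (x : Tens A M N) : map f' g' (map f g x) = map (f' ∘ₗ f) (g' ∘ₗ g) x :=
  DFunLike.congr_fun (hom_ext (f := (map f' g').comp (map f g)) (g := map (f' ∘ₗ f) (g' ∘ₗ g))
    fun _ _ => rfl) x

end Basic

section Actions

variable {M N : Type*} [AddCommGroup M] [AddCommGroup N] [Module Aᵐᵒᵖ M] [Module A N]

/-- If `M` is a bimodule, `A` acts on `M ⊗_A N` on the left: `a (m ⊗ n) = a m ⊗ n`. -/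
instance leftModule [Module A M] [SMulCommClass A Aᵐᵒᵖ M] : Module A (Tens A M N) where
  smul a := map (Module.toModuleEnd Aᵐᵒᵖ (S := A) M a) LinearMap.id
  one_smul x := by
    change map _ _ x = x
    rw [map_one]
    exact DFunLike.congr_fun (map_id (A := A) (M := M) (N := N)) x
  mul_smul a b x := by
    change map _ _ x = map _ _ (map _ _ x)
    rw [map_map, map_mul]
    rfl
  smul_zero a := map_zero (map _ _)
  smul_add a := map_add (map _ _)
  add_smul a b x := by
    change map _ _ x = map _ _ x + map _ _ x
    induction x using Tens.induction with
    | tmul m n => simp [add_smul, add_tmul]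
    | add x y hx hy => simp only [map_add (map _ _) x y, hx, hy]; abel
  zero_smul x := by
    change map _ _ x = 0
    induction x using Tens.induction with
    | tmul m n => simpa using (add_tmul (A := A) (0 : M) 0 n)
    | add x y hx hy => rw [map_add, hx, hy, add_zero]

theorem smul_tmul [Module A M] [SMulCommClass A Aᵐᵒᵖ M] (a : A) (m : M) (n : N) :
    a • tmul A m n = tmul A (a • m) n := rfl

/-- If `N` is a bimodule, `A` acts on `M ⊗_A N` on the right: `(m ⊗ n) a = m ⊗ n a`. -/
instance rightModule [Module Aᵐᵒᵖ N] [SMulCommClass A Aᵐᵒᵖ N] : Module Aᵐᵒᵖ (Tens A M N) where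
  smul a := map LinearMap.id
    { toFun := fun n => a • n
      map_add' := smul_add a
      map_smul' := fun b n => (smul_comm b a n).symm }
  one_smul x := by
    change map _ _ x = x
    induction x using Tens.induction with
    | tmul m n => simp
    | add x y hx hy => rw [map_add, hx, hy]
  mul_smul a b x := by
    change map _ _ x = map _ _ (map _ _ x)
    induction x using Tens.induction with
    | tmul m n => simp [mul_smul]
    | add x y hx hy => rw [map_add, map_add, map_add, hx, hy]
  smul_zero a := map_zero (map _ _)
  smul_add a := map_add (map _ _)
  add_smul a b x := by
    change map _ _ x = map _ _ x + map _ _ x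
    induction x using Tens.induction with
    | tmul m n => simp [add_smul, tmul_add]
    | add x y hx hy => rw [map_add, map_add, map_add, hx, hy]; abel
  zero_smul x := by
    change map _ _ x = 0
    induction x using Tens.induction with
    | tmul m n => simpa using (tmul_add (A := A) m (0 : N) 0)
    | add x y hx hy => rw [map_add, hx, hy, add_zero]

theorem op_smul_tmul' [Module Aᵐᵒᵖ N] [SMulCommClass A Aᵐᵒᵖ N] (a : Aᵐᵒᵖ) (m : M) (n : N) :
    a • tmul A m n = tmul A m (a • n) := rfl

instance [Module A M] [SMulCommClass A Aᵐᵒᵖ M] [Module Aᵐᵒᵖ N] [SMulCommClass A Aᵐᵒᵖ N] :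
    SMulCommClass A Aᵐᵒᵖ (Tens A M N) where
  smul_comm a b x := by
    induction x using Tens.induction with
    | tmul m n => rfl
    | add x y hx hy => rw [smul_add, smul_add, smul_add, smul_add, hx, hy]

end Actions

end Tens

/-! ### Bimodule maps -/

section Bimodules

variable (A : Type u) [Ring A]

/-- Homomorphisms of `(A, A)`-bimodules. -/
structure BimodHom (M : Type v) (N : Type w) [AddCommGroup M] [AddCommGroup N] [Module A M]
    [Module Aᵐᵒᵖ M] [Module A N] [Module Aᵐᵒᵖ N] extends M →+ N where
  map_smul' : ∀ (a : A) (m : M), toFun (a • m) = a • toFun m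
  map_op_smul' : ∀ (a : Aᵐᵒᵖ) (m : M), toFun (a • m) = a • toFun m

namespace BimodHom

variable {A} {M N : Type*} [AddCommGroup M] [AddCommGroup N] [Module A M]
    [Module Aᵐᵒᵖ M] [Module A N] [Module Aᵐᵒᵖ N]

/-- A bimodule map as a left `A`-linear map. -/
def left (f : BimodHom A M N) : M →ₗ[A] N :=
  { f.toAddMonoidHom with map_smul' := f.map_smul' }

/-- A bimodule map as a right `A`-linear map. -/
def right (f : BimodHom A M N) : M →ₗ[Aᵐᵒᵖ] N :=
  { f.toAddMonoidHom with map_smul' := f.map_op_smul' }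

instance : CoeFun (BimodHom A M N) (fun _ => M → N) := ⟨fun f => f.toFun⟩

end BimodHom

end Bimodules

namespace Tens

variable {A : Type u} [Ring A]

section Unitors

variable {M N : Type*} [AddCommGroup M] [AddCommGroup N] [Module Aᵐᵒᵖ M] [Module A N]

/-- The canonical map `M ⊗_A A → M`, `m ⊗ a ↦ m a`. -/
def rid : Tens A M A →+ M :=
  lift (mkBiadd (fun m a => op a • m) (fun m m' a => smul_add _ _ _)
    (fun m a b => by simp [add_smul]))
    (fun m a b => by simp [mul_smul])

/-- The canonical map `A ⊗_A N → N`, `a ⊗ n ↦ a n`. -/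
def lid : Tens A A N →+ N :=
  lift (mkBiadd (fun a n => a • n) (fun a b n => add_smul _ _ _) (fun a n n' => smul_add _ _ _))
    (fun a b n => by simp [mul_smul])

@[simp] theorem rid_tmul (m : M) (a : A) : rid (tmul A m a) = op a • m := rfl

@[simp] theorem lid_tmul (a : A) (n : N) : lid (tmul A a n) = a • n := rfl

end Unitors

section Assoc

variable {M N P : Type*} [AddCommGroup M] [AddCommGroup N] [AddCommGroup P] [Module Aᵐᵒᵖ M]
  [Module A N] [Module Aᵐᵒᵖ N] [SMulCommClass A Aᵐᵒᵖ N] [Module A P]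

variable (A M N P) in
/-- The map `(m ⊗ n) ⊗ p ↦ m ⊗ (n ⊗ p)`. -/
def assocHom : Tens A (Tens A M N) P →+ Tens A M (Tens A N P) :=
  lift (AddMonoidHom.flip (mkBiadd
      (fun p x => lift (mkBiadd (fun m n => tmul A m (tmul A n p))
        (fun m m' n => add_tmul _ _ _)
        (fun m n n' => by rw [add_tmul, tmul_add]))
        (fun m a n => by
          simp only [mkBiadd_apply]
          rw [op_smul_tmul, smul_tmul]) x)
      (fun p p' x => by
        induction x using Tens.induction with
        | tmul m n => simp [tmul_add]
        | add x y hx hy => rw [map_add, map_add, map_add, hx, hy]; abel)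
      (fun p x y => map_add _ _ _)))
    (fun x a p => by
      induction x using Tens.induction with
      | tmul m n =>
        simp only [op_smul_tmul', AddMonoidHom.flip_apply, mkBiadd_apply, lift_tmul]
        rw [op_smul_tmul]
      | add x y hx hy =>
        simp only [smul_add, map_add, AddMonoidHom.add_apply, hx, hy])

variable (A M N P) in
/-- The map `m ⊗ (n ⊗ p) ↦ (m ⊗ n) ⊗ p`. -/
def assocInv : Tens A M (Tens A N P) →+ Tens A (Tens A M N) P :=
  lift (mkBiadd
      (fun m x => lift (mkBiadd (fun n p => tmul A (tmul A m n) p)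
        (fun n n' p => by rw [tmul_add, add_tmul])
        (fun n p p' => tmul_add _ _ _))
        (fun n a p => by
          simp only [mkBiadd_apply]
          rw [← op_smul_tmul', op_smul_tmul]) x)
      (fun m m' x => by
        induction x using Tens.induction with
        | tmul n p => simp [add_tmul]
        | add x y hx hy => rw [map_add, map_add, map_add, hx, hy]; abel)
      (fun m x y => map_add _ _ _))
    (fun m a x => by
      induction x using Tens.induction with
      | tmul n p =>
        simp only [smul_tmul, mkBiadd_apply, lift_tmul]
        rw [op_smul_tmul]
      | add x y hx hy =>
        simp only [smul_add, map_add, hx, hy])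

/-- The associativity isomorphism `(M ⊗_A N) ⊗_A P ≃ M ⊗_A (N ⊗_A P)`. -/
def assoc : Tens A (Tens A M N) P ≃+ Tens A M (Tens A N P) :=
  AddMonoidHom.toAddEquiv (assocHom A M N P) (assocInv A M N P)
    (hom_ext fun x p => by
      induction x using Tens.induction with
      | tmul m n => rfl
      | add x y hx hy => rw [add_tmul, map_add, map_add, hx, hy])
    (hom_ext fun m x => by
      induction x using Tens.induction with
      | tmul n p => rfl
      | add x y hx hy => rw [tmul_add, map_add, map_add, hx, hy])

@[simp] theorem assoc_tmul (m : M) (n : N) (p : P) :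
    assoc (tmul A (tmul A m n) p) = tmul A m (tmul A n p) := rfl

@[simp] theorem assoc_symm_tmul (m : M) (n : N) (p : P) :
    assoc.symm (tmul A m (tmul A n p)) = tmul A (tmul A m n) p := rfl

end Assoc

section RightLinear

variable {M M' M'' N N' : Type*} [AddCommGroup M] [AddCommGroup N] [Module Aᵐᵒᵖ M]
  [Module A N] [AddCommGroup M'] [AddCommGroup N'] [Module Aᵐᵒᵖ M'] [Module A N']
  [Module Aᵐᵒᵖ N] [Module Aᵐᵒᵖ N'] [SMulCommClass A Aᵐᵒᵖ N] [SMulCommClass A Aᵐᵒᵖ N']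

variable (N) in
/-- The right `A`-linear map `f ⊗ N : M ⊗_A N → M' ⊗_A N` for a bimodule `N`. -/
def rTensor (f : M →ₗ[Aᵐᵒᵖ] M') : Tens A M N →ₗ[Aᵐᵒᵖ] Tens A M' N :=
  { map f (LinearMap.id : N →ₗ[A] N) with
    map_smul' := fun a x => by
      induction x using Tens.induction with
      | tmul m n => rfl
      | add x y hx hy => simp_all [smul_add] }

@[simp] theorem rTensor_tmul (f : M →ₗ[Aᵐᵒᵖ] M') (m : M) (n : N) :
    rTensor N f (tmul A m n) = tmul A (f m) n := rfl

end RightLinear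

end Tens

/-! ### Corings -/

/-- An `A`-coring: an `(A, A)`-bimodule `C` with a coassociative coproduct and a counit, both
`(A, A)`-bimodule maps. -/
class Coring (A : Type u) (C : Type v) [Ring A] [AddCommGroup C] [Module A C] [Module Aᵐᵒᵖ C]
    [SMulCommClass A Aᵐᵒᵖ C] where
  comul : BimodHom A C (Tens A C C)
  counit : BimodHom A C A
  coassoc : ∀ c : C, Tens.assoc (Tens.map comul.right LinearMap.id (comul c)) =
    Tens.map LinearMap.id comul.left (comul c)
  counit_left : ∀ c : C, Tens.lid (Tens.map counit.right LinearMap.id (comul c)) = c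
  counit_right : ∀ c : C, Tens.rid (Tens.map LinearMap.id counit.left (comul c)) = c

section Comodules

variable (A C : Type u) [Ring A] [AddCommGroup C] [Module A C] [Module Aᵐᵒᵖ C]
  [SMulCommClass A Aᵐᵒᵖ C] [Coring A C]

/-- Right `C`-comodules: right `A`-modules `M` with a coassociative counital right `A`-linear
coaction `M → M ⊗_A C`. -/
structure Comod where
  carrier : ModuleCat.{u} Aᵐᵒᵖ
  coact : carrier →ₗ[Aᵐᵒᵖ] Tens A carrier C
  coassoc : ∀ m : carrier, Tens.assoc (Tens.map coact LinearMap.id (coact m)) =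
    Tens.map LinearMap.id (Coring.comul (A := A) (C := C)).left (coact m)
  counit : ∀ m : carrier,
    Tens.rid (Tens.map LinearMap.id (Coring.counit (A := A) (C := C)).left (coact m)) = m

namespace Comod

variable {A C}

/-- Morphisms of right `C`-comodules: right `A`-linear maps compatible with the coactions. -/
@[ext] structure Hom (M N : Comod A C) where
  hom : M.carrier ⟶ N.carrier
  colinear : ∀ m : M.carrier, N.coact (hom.hom m) = Tens.map hom.hom LinearMap.id (M.coact m)

instance : Category (Comod A C) where
  Hom := Hom
  id M :=
    { hom := 𝟙 M.carrier
      colinear := fun m => by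
        simp [Tens.map_id] }
  comp f g :=
    { hom := f.hom ≫ g.hom
      colinear := fun m => by
        simp [f.colinear, g.colinear, Tens.map_map] }

@[ext] theorem hom_ext' {M N : Comod A C} {f g : M ⟶ N} (h : f.hom = g.hom) : f = g :=
  Hom.ext h

@[simp] theorem id_hom (M : Comod A C) : Hom.hom (𝟙 M) = 𝟙 M.carrier := rfl

@[simp] theorem comp_hom {M N P : Comod A C} (f : M ⟶ N) (g : N ⟶ P) :
    (f ≫ g).hom = f.hom ≫ g.hom := rfl

variable (A C)

/-- The forgetful functor from right `C`-comodules to right `A`-modules. -/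
def forget : Comod A C ⥤ ModuleCat.{u} Aᵐᵒᵖ where
  obj M := M.carrier
  map f := f.hom

variable (M : Type u) [AddCommGroup M] [Module Aᵐᵒᵖ M]

/-- The coaction `M ⊗ Δ : M ⊗_A C → M ⊗_A C ⊗_A C`. -/
def freeCoact : Tens A M C →ₗ[Aᵐᵒᵖ] Tens A (Tens A M C) C :=
  { Tens.assoc.symm.toAddMonoidHom.comp
      (Tens.map LinearMap.id (Coring.comul (A := A) (C := C)).left) with
    map_smul' := fun a x => by
      induction x using Tens.induction with
      | tmul m c =>
        change Tens.assoc.symm (Tens.tmul A m (Coring.comul (A := A) (a • c))) =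
          a • Tens.assoc.symm (Tens.tmul A m (Coring.comul (A := A) c))
        rw [show (Coring.comul (A := A) (a • c) : Tens A C C) = a • Coring.comul (A := A) c from
          Coring.comul.map_op_smul' a c]
        induction (Coring.comul (A := A) c : Tens A C C) using Tens.induction with
        | tmul c d => rfl
        | add x y hx hy => simp only [smul_add, Tens.tmul_add, map_add, hx, hy]
      | add x y hx hy => simp_all [smul_add] }

theorem freeCoact_tmul (m : M) (c : C) : freeCoact A C M (Tens.tmul A m c) =
    Tens.assoc.symm (Tens.tmul A m (Coring.comul (A := A) c)) := rfl

theorem assoc_freeCoact (m : M) (d : Tens A C C) :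
    Tens.assoc (Tens.map (freeCoact A C M) (LinearMap.id : C →ₗ[A] C)
      (Tens.assoc.symm (Tens.tmul A m d))) =
    Tens.assoc.symm (Tens.tmul A m (Tens.assoc (Tens.map (Coring.comul (A := A) (C := C)).right
      LinearMap.id d))) := by
  induction d using Tens.induction with
  | tmul c c' =>
    rw [Tens.assoc_symm_tmul, Tens.map_tmul, Tens.map_tmul, freeCoact_tmul]
    change Tens.assoc (Tens.tmul A (Tens.assoc.symm (Tens.tmul A m (Coring.comul (A := A) c))) c') =
      Tens.assoc.symm (Tens.tmul A m (Tens.assoc (Tens.tmul A (Coring.comul (A := A) c) c')))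
    induction (Coring.comul (A := A) c : Tens A C C) using Tens.induction with
    | tmul c d => rfl
    | add x y hx hy => simp only [Tens.add_tmul, Tens.tmul_add, map_add, hx, hy]
  | add x y hx hy => simp only [Tens.tmul_add, map_add, hx, hy]

/-- The right `C`-comodule `M ⊗_A C`. -/
def freeObj : Comod A C where
  carrier := ModuleCat.of Aᵐᵒᵖ (Tens A M C)
  coact := freeCoact A C M
  coassoc x := by
    induction x using Tens.induction with
    | tmul m c =>
      rw [freeCoact_tmul, assoc_freeCoact, Coring.coassoc]
      induction (Coring.comul (A := A) c : Tens A C C) using Tens.induction with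
      | tmul c d => rfl
      | add x y hx hy => simp only [Tens.tmul_add, map_add, hx, hy]
    | add x y hx hy => simp only [map_add, hx, hy]
  counit x := by
    induction x using Tens.induction with
    | tmul m c =>
      rw [freeCoact_tmul]
      refine Eq.trans ?_ (congrArg (Tens.tmul A m) (Coring.counit_right (A := A) c))
      induction (Coring.comul (A := A) c : Tens A C C) using Tens.induction with
      | tmul c d => rfl
      | add x y hx hy => simp only [Tens.tmul_add, map_add, hx, hy]
    | add x y hx hy => simp only [map_add, hx, hy]

/-- The functor `- ⊗_A C` from right `A`-modules to right `C`-comodules. -/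
def free : ModuleCat.{u} Aᵐᵒᵖ ⥤ Comod A C where
  obj M := freeObj A C M
  map {M N} f :=
    { hom := ModuleCat.ofHom (Tens.rTensor C f.hom)
      colinear := fun x => by
        change freeCoact A C N (Tens.rTensor C f.hom x) =
          Tens.map (Tens.rTensor C f.hom) LinearMap.id (freeCoact A C M x)
        induction x using Tens.induction with
        | tmul m c =>
          rw [Tens.rTensor_tmul, freeCoact_tmul, freeCoact_tmul]
          induction (Coring.comul (A := A) c : Tens A C C) using Tens.induction with
          | tmul c d => rfl
          | add x y hx hy => simp only [Tens.tmul_add, map_add, hx, hy]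
        | add x y hx hy => simp only [map_add, hx, hy] }
  map_id M := by
    ext x
    exact DFunLike.congr_fun (Tens.map_id (A := A) (M := M) (N := C)) x
  map_comp f g := by
    ext x
    exact (Tens.map_map g.hom (LinearMap.id : C →ₗ[A] C) f.hom LinearMap.id x).symm

end Comod

end Comodules

/-! ### Separable and Frobenius functors -/

section Functors

universe v₁ v₂ u₁ u₂

variable {X : Type u₁} [Category.{v₁} X] {Y : Type u₂} [Category.{v₂} Y]

/-- A functor `F` is separable if the natural transformation `Hom(-, -) ⟶ Hom(F -, F -)` given by
`F` has a natural left inverse `φ`. -/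
def IsSeparableFunctor (F : X ⥤ Y) : Prop :=
  ∃ φ : ∀ a b : X, (F.obj a ⟶ F.obj b) → (a ⟶ b),
    (∀ (a b : X) (f : a ⟶ b), φ a b (F.map f) = f) ∧
    ∀ (a' a b b' : X) (f : a' ⟶ a) (g : F.obj a ⟶ F.obj b) (h : b ⟶ b'),
      φ a' b' (F.map f ≫ g ≫ F.map h) = f ≫ φ a b g ≫ h

/-- A functor is Frobenius if some functor is both a left and a right adjoint of it. -/
def IsFrobeniusFunctor (F : X ⥤ Y) : Prop :=
  ∃ G : Y ⥤ X, Nonempty (G ⊣ F) ∧ Nonempty (F ⊣ G)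

end Functors

/-! ### Properties of corings -/

section Properties

variable (A C : Type u) [Ring A] [AddCommGroup C] [Module A C] [Module Aᵐᵒᵖ C]
  [SMulCommClass A Aᵐᵒᵖ C]

/-- The bimodule `C` is centrally projective: `C ⊕ W ≅ Aⁿ` as `(A, A)`-bimodules, for some
`(A, A)`-bimodule `W` and some `n`. -/
def IsCentrallyProjective : Prop :=
  ∃ (n : ℕ) (W : Type u) (_ : AddCommGroup W) (_ : Module A W) (_ : Module Aᵐᵒᵖ W)
    (_ : SMulCommClass A Aᵐᵒᵖ W) (f : BimodHom A (C × W) (Fin n → A)), Function.Bijective f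

variable [Coring A C]

/-- The coring `C` is coseparable: the coproduct has a splitting `π : C ⊗_A C → C` that is a map of
`(C, C)`-bicomodules, i.e. `(A, A)`-bilinear and colinear for the right coactions `C ⊗ Δ`, `Δ` and
the left coactions `Δ ⊗ C`, `Δ`. -/
def IsCoseparable : Prop :=
  ∃ π : BimodHom A (Tens A C C) C,
    (∀ c : C, π (Coring.comul (A := A) c) = c) ∧
    (∀ x : Tens A C C, Coring.comul (A := A) (π x) =
      Tens.map π.right LinearMap.id
        (Tens.assoc.symm (Tens.map LinearMap.id (Coring.comul (A := A) (C := C)).left x))) ∧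
    (∀ x : Tens A C C, Coring.comul (A := A) (π x) =
      Tens.map LinearMap.id π.left
        (Tens.assoc (Tens.map (Coring.comul (A := A) (C := C)).right LinearMap.id x)))

/-- The coring `C` is cosplit: the functor `- ⊗_A C` from right `A`-modules to right
`C`-comodules is separable. -/
def IsCosplit : Prop := IsSeparableFunctor (Comod.free A C)

/-- The coring `C` is Frobenius: the forgetful functor from right `C`-comodules to right
`A`-modules is a Frobenius functor. -/
def IsFrobenius : Prop := IsFrobeniusFunctor (Comod.forget A C)

end Properties

end CoringTheory

/-! Let Z be the center of A and let S be the Z-algebra of bimodule maps C → A under convolution,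
with unit ε. Central projectivity gives functionals F_i and elements z_i commuting with A such that
c = Σ F_i(c) z_i. Hence S is finitely generated projective over Z, elements of C are separated by S,
and S ⊗_Z S is identified with the bimodule maps C ⊗_A C → A (`tensorForm`). In this dictionary ε ∘
π is a separability idempotent, so S is a separable Z-algebra (`IsCoseparable.isSeparableAlgebra`).
Conversely, a symmetric nondegenerate form t on S and its Casimir element become an element of C
commuting with A and a functional γ on C ⊗_A C, which are the unit and the counit of an adjunction
making - ⊗_A C left adjoint to the forgetful functor (`exists_isFrobeniusSystem`,
`freeForgetAdjunction`).

The remaining point is that a finitely generated projective separable algebra S over a commutative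
ring R has such a form. Over an algebraically closed field S is a product of matrix algebras and the
sum of the block traces works. In general a splitting is encoded by finitely many polynomial
equations, those of a split system: the e_i play the role of one corner matrix unit per block, and 1
= Σ u_a e_{c(a)} v_a. The e_i may vanish, so one pair of index sets serves all fibers, although the
blocks vary. The resulting trace is independent of the split system (`splitTrace_eq`), so it
descends along any faithfully flat extension carrying one. The coordinate ring of the scheme of
split systems is such an extension: it is smooth because split systems lift along square-zero
extensions (`IsSplitPoint.exists_lift`), and Wedderburn's theorem provides geometric points over
every maximal ideal (`faithfullyFlat_splitRing`). -/

namespace CoringTheory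

/-! ### Split systems of idempotents -/

section SplitSystem

variable {B T ι α : Type*} [CommRing B] [Ring T] [Algebra B T]

/-- Idempotents `e i` of a `B`-algebra `T` whose corners are spanned by `e i`, which are orthogonal
in the strong sense that `e i * T * e j = 0` for `i ≠ j`, and which generate the unit ideal. -/
structure IsSplitSystem [DecidableEq ι] [Fintype α] (c : α → ι) (e : ι → T)
    (l : ι → T →ₗ[B] B) (u v : α → T) : Prop where
  corner : ∀ i j x, e i * x * e j = if i = j then l i x • e i else 0
  idem : ∀ i, e i * e i = e i
  full : ∑ a, u a * e (c a) * v a = 1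

/-- A functional `l` with `f * x * f = l x • f`, rescaled to be supported where `f` is. -/
def cornerForm (f : T) (l : T →ₗ[B] B) : T →ₗ[B] B := l f • l

/-! ### Functionals attached to idempotents of rank at most one -/

section Corner

variable {f : T} {l : T →ₗ[B] B} (hf : f * f = f) (hl : ∀ x, f * x * f = l x • f)

include hf hl

theorem corner_smul_self : l f • f = f := by rw [← hl, hf, hf]

/-- As `f` may vanish on part of the spectrum, `l f` need not be 1; it is the idempotent of `B`
cutting out the locus where `f` has rank one. -/
theorem corner_idem : l f * l f = l f := by
  have := congrArg l (corner_smul_self hf hl)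
  rwa [map_smul, smul_eq_mul] at this

theorem cornerForm_self : cornerForm f l f = l f := by
  simp [cornerForm, corner_idem hf hl]

theorem mul_cornerForm (x : T) : l f * cornerForm f l x = cornerForm f l x := by
  simp [cornerForm, ← mul_assoc, corner_idem hf hl]

theorem cornerForm_smul (x : T) : cornerForm f l x • f = f * x * f := by
  rw [hl, cornerForm, LinearMap.smul_apply, smul_eq_mul, mul_comm, mul_smul,
    corner_smul_self hf hl]

theorem cornerForm_one : cornerForm f l 1 = l f := by
  have h := cornerForm_smul hf hl 1
  rw [mul_one, hf] at h
  have := congrArg l h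
  rw [map_smul, smul_eq_mul] at this
  rwa [mul_comm, mul_cornerForm hf hl] at this

/-- Scalars cannot be cancelled from `f` in general, but values of `cornerForm` lie in the ideal
generated by `l f`, on which the action on `f` is faithful. -/
theorem cornerForm_smul_right (x : T) {b : B} (h : (b * cornerForm f l x) • f = 0) :
    b * cornerForm f l x = 0 := by
  have := congrArg l h
  rw [map_smul, smul_eq_mul, map_zero, mul_assoc, mul_comm _ (l f), mul_cornerForm hf hl] at this
  exact this

end Corner

/-- The trace functional of a split system. -/
def splitTrace [Fintype α] (c : α → ι) (e : ι → T) (l : ι → T →ₗ[B] B) (u v : α → T) : T →ₗ[B] B :=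
  ∑ a, cornerForm (e (c a)) (l (c a)) ∘ₗ LinearMap.mulLeft B (v a) ∘ₗ LinearMap.mulRight B (u a)

theorem splitTrace_apply [Fintype α] (c : α → ι) (e : ι → T) (l : ι → T →ₗ[B] B)
    (u v : α → T) (x : T) :
    splitTrace c e l u v x = ∑ a, cornerForm (e (c a)) (l (c a)) (v a * (x * u a)) := by
  simp [splitTrace]

/-! ### The trace of a split system -/

namespace IsSplitSystem

variable [DecidableEq ι] [Fintype α] {c : α → ι} {e : ι → T} {l : ι → T →ₗ[B] B} {u v : α → T}
  (h : IsSplitSystem c e l u v)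

include h

theorem corner_self (i : ι) (x : T) : e i * x * e i = l i x • e i := by
  rw [h.corner, if_pos rfl]

/-- The model is (x E₀₀ y)₀₀ = x₀₀ y₀₀ in a matrix block, distinct blocks being orthogonal. -/
theorem cornerForm_mul (i j : ι) (x y : T) : cornerForm (e i) (l i) (x * e j * y) =
    if i = j then cornerForm (e i) (l i) x * cornerForm (e i) (l i) y else 0 := by
  have key : cornerForm (e i) (l i) (x * e j * y) • e i =
      (if i = j then cornerForm (e i) (l i) x * cornerForm (e i) (l i) y else 0) • e i := by
    rw [cornerForm_smul (h.idem i) (h.corner_self i)]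
    have : e i * (x * e j * y) * e i = (e i * x * e j) * y * e i := by noncomm_ring
    rw [this, h.corner]
    split_ifs with hij
    · rw [smul_mul_assoc, smul_mul_assoc, ← cornerForm_smul (h.idem i) (h.corner_self i) y,
        smul_comm, ← h.corner_self i x, ← cornerForm_smul (h.idem i) (h.corner_self i) x, smul_smul,
        mul_comm]
    · simp
  have := congrArg (cornerForm (e i) (l i)) key
  rw [map_smul, map_smul, cornerForm_self (h.idem i) (h.corner_self i), smul_eq_mul, smul_eq_mul,
    mul_comm, mul_cornerForm (h.idem i) (h.corner_self i)] at this
  rw [this]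
  split_ifs
  · rw [mul_assoc, mul_comm _ (l i (e i)), mul_cornerForm (h.idem i) (h.corner_self i)]
  · simp

/-- Inserting 1 = Σ u_b e v_b between the factors writes the trace of a product as Σ X_ab Y_ba over
pairs in the same block, which is symmetric because `B` is commutative. -/
theorem splitTrace_mul_comm (x y : T) :
    splitTrace c e l u v (x * y) = splitTrace c e l u v (y * x) := by
  have key (x y : T) : splitTrace c e l u v (x * y) = ∑ a, ∑ b, if c a = c b then
      cornerForm (e (c a)) (l (c a)) (v a * x * u b) *
        cornerForm (e (c a)) (l (c a)) (v b * y * u a) else 0 := by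
    rw [splitTrace_apply]
    refine Finset.sum_congr rfl fun a _ => ?_
    have : v a * (x * y * u a) =
        ∑ b, (v a * x * u b) * e (c b) * (v b * y * u a) := by
      calc v a * (x * y * u a) = (v a * x) * 1 * (y * u a) := by noncomm_ring
        _ = _ := by
          rw [← h.full, Finset.mul_sum, Finset.sum_mul]
          exact Finset.sum_congr rfl fun b _ => by noncomm_ring
    rw [this, map_sum]
    exact Finset.sum_congr rfl fun b _ => h.cornerForm_mul _ _ _ _
  rw [key, key, Finset.sum_comm]
  refine Finset.sum_congr rfl fun a _ => Finset.sum_congr rfl fun b _ => ?_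
  by_cases hab : c a = c b
  · rw [if_pos hab, if_pos hab.symm, hab, mul_comm]
  · rw [if_neg hab, if_neg (Ne.symm hab)]

/-- The elements u_a e v_b with a and b in one block behave as matrix units, and u_b e v_a is
trace-dual to u_a e v_b. -/
theorem eq_sum_splitTrace (x : T) : x = ∑ a, ∑ b, if c a = c b then
    splitTrace c e l u v (x * (u b * e (c a) * v a)) • (u a * e (c a) * v b) else 0 := by
  have tr (a b : α) (hab : c a = c b) : splitTrace c e l u v (x * (u b * e (c a) * v a)) =
      cornerForm (e (c a)) (l (c a)) (v a * x * u b) := by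
    rw [h.splitTrace_mul_comm, splitTrace_apply]
    have (d : α) : cornerForm (e (c d)) (l (c d)) (v d * (u b * e (c a) * v a * x * u d)) =
        if c d = c a then cornerForm (e (c d)) (l (c d)) (v d * u b) *
          cornerForm (e (c d)) (l (c d)) (v a * x * u d) else 0 := by
      rw [← h.cornerForm_mul]; congr 1; noncomm_ring
    have h1 : v a * x * u b = ∑ d, (v a * x * u d) * e (c d) * (v d * u b) := by
      calc v a * x * u b = (v a * x) * 1 * u b := by noncomm_ring
        _ = _ := by
          rw [← h.full, Finset.mul_sum, Finset.sum_mul]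
          exact Finset.sum_congr rfl fun b _ => by noncomm_ring
    rw [h1, map_sum]
    refine Finset.sum_congr rfl fun d _ => ?_
    have h2 := this d
    rw [mul_assoc _ x (u d)] at h2
    rw [h.cornerForm_mul, mul_assoc _ x (u d), h2]
    by_cases hd : c d = c a
    · rw [if_pos hd, if_pos hd.symm, hd, mul_comm]
    · rw [if_neg hd, if_neg (Ne.symm hd)]
  calc x = 1 * x * 1 := by simp
    _ = ∑ a, ∑ b, u a * (e (c a) * (v a * x * u b) * e (c b)) * v b := by
      rw [← h.full, Finset.sum_mul, Finset.sum_mul]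
      refine Finset.sum_congr rfl fun a _ => ?_
      rw [Finset.mul_sum]
      exact Finset.sum_congr rfl fun b _ => by noncomm_ring
    _ = _ := by
      refine Finset.sum_congr rfl fun a _ => Finset.sum_congr rfl fun b _ => ?_
      by_cases hab : c a = c b
      · rw [if_pos hab, tr a b hab, ← hab, ← cornerForm_smul (h.idem _) (h.corner_self _)]
        simp
      · rw [if_neg hab, h.corner, if_neg hab]; simp

/-- The trace functional of a split system is nondegenerate. -/
theorem exists_splitTrace_mul (g : T →ₗ[B] B) : ∃ q, ∀ x, splitTrace c e l u v (q * x) = g x := by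
  -- The representing element has as coefficients the values of `g` on the matrix units, placed at
  -- the transposed units.
  refine ⟨∑ a, ∑ b, if c a = c b then
    g (u a * e (c a) * v b) • (u b * e (c a) * v a) else 0, fun x => ?_⟩
  rw [h.splitTrace_mul_comm]
  conv_rhs => rw [h.eq_sum_splitTrace x]
  simp only [Finset.mul_sum, map_sum]
  refine Finset.sum_congr rfl fun a _ => Finset.sum_congr rfl fun b _ => ?_
  split_ifs
  · rw [mul_smul_comm, map_smul, map_smul, smul_eq_mul, smul_eq_mul, mul_comm]
  · simp

/-- Cyclicity moves every term into a corner e T e, where elements are multiples of e; thus a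
symmetric functional is determined by its values on the e_i. -/
theorem symmetric_eq_sum (s : T →ₗ[B] B) (hs : ∀ x y, s (x * y) = s (y * x)) (x : T) :
    s x = ∑ a, cornerForm (e (c a)) (l (c a)) (v a * (x * u a)) * s (e (c a)) := by
  have : s x = ∑ a, s (e (c a) * (v a * (x * u a)) * e (c a)) := by
    calc s x = s (1 * x) := by rw [one_mul]
      _ = ∑ a, s ((u a * e (c a)) * (e (c a) * v a * x)) := by
        rw [← h.full, Finset.sum_mul, map_sum]
        refine Finset.sum_congr rfl fun a _ => ?_
        congr 1
        calc _ = u a * e (c a) * v a * x := rfl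
          _ = u a * (e (c a) * e (c a)) * v a * x := by rw [h.idem]
          _ = _ := by noncomm_ring
      _ = _ := by
        refine Finset.sum_congr rfl fun a _ => ?_
        rw [hs]; congr 1; noncomm_ring
  rw [this]
  refine Finset.sum_congr rfl fun a _ => ?_
  rw [← cornerForm_smul (h.idem _) (h.corner_self _), map_smul, smul_eq_mul]

/-- The trace functional of a split system takes the value "rank of `f`" at an idempotent `f` of
rank at most one. -/
theorem splitTrace_corner {f : T} {m : T →ₗ[B] B} (hf : f * f = f)
    (hm : ∀ x, f * x * f = m x • f) : splitTrace c e l u v f = m f := by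
  set t := splitTrace c e l u v f with ht
  let p (a : α) : B := cornerForm (e (c a)) (l (c a)) (v a * (f * u a))
  -- Both `f` and e = e_{c(a)} have rank at most one: `p a` is the coefficient of e v_a f u_a e
  -- along e, and `q a` that of f u_a e v_a f along f. The sums are Σ p = t and Σ q = m f, so the
  -- goal is Σ p = Σ q.
  let q (a : α) : B := cornerForm f m (u a * e (c a) * v a)
  have hp (a : α) : p a • e (c a) = e (c a) * v a * f * u a * e (c a) := by
    rw [cornerForm_smul (h.idem _) (h.corner_self _)]; noncomm_ring
  have hq (a : α) : q a • f = f * u a * e (c a) * v a * f := by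
    rw [cornerForm_smul hf hm]; noncomm_ring
  have htp : t = ∑ a, p a := splitTrace_apply ..
  have hqs : ∑ a, q a = m f := by
    rw [← cornerForm_one hf hm, ← h.full, map_sum]
  have h0 (a b : α) (hab : c a ≠ c b) : q a * p b = 0 := by
    refine cornerForm_smul_right (h.idem _) (h.corner_self _) _ ?_
    change (q a * p b) • e (c b) = 0
    rw [mul_smul, hp]
    have : q a • (e (c b) * v b * f * u b * e (c b)) =
        e (c b) * v b * (q a • f) * u b * e (c b) := by simp
    rw [this, hq]
    have : e (c b) * v b * (f * u a * e (c a) * v a * f) * u b * e (c b) =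
        (e (c b) * (v b * f * u a) * e (c a)) * v a * f * u b * e (c b) := by noncomm_ring
    rw [this, h.corner, if_neg (Ne.symm hab)]; simp
  have h1 (a b : α) (hab : c a = c b) : (p b * q a) • f =
      (f * (u a * e (c a) * v b) * f) * (f * (u b * e (c b) * v a) * f) := by
    rw [mul_smul, hq]
    have : p b • (f * u a * e (c a) * v a * f) = f * u a * (p b • e (c b)) * v a * f := by
      simp [hab]
    rw [this, hp, hab]
    calc _ = f * u a * e (c b) * v b * f * u b * e (c b) * v a * f := by noncomm_ring
      _ = f * u a * e (c b) * v b * (f * f) * u b * e (c b) * v a * f := by rw [hf]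
      _ = _ := by noncomm_ring
  -- By `h1` the two products, multiplied by `f`, are products of the same two elements of the
  -- commutative corner f T f, in opposite orders.
  have h2 (a b : α) : p b * q a = p a * q b := by
    by_cases hab : c a = c b
    · have key : (p b * q a - p a * q b) • f = 0 := by
        rw [sub_smul, h1 a b hab, h1 b a hab.symm, hm, hm]
        simp [smul_smul, hf, mul_comm]
      have := congrArg m key
      rw [map_smul, map_zero, smul_eq_mul, sub_mul, mul_assoc, mul_assoc, mul_comm _ (m f),
        mul_comm _ (m f), mul_cornerForm hf hm, mul_cornerForm hf hm] at this
      exact sub_eq_zero.1 this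
    · rw [mul_comm, h0 a b hab, mul_comm, h0 b a (Ne.symm hab)]
  have h3 (a : α) : q a * q a = p a * q a := by
    have key : (q a * q a - p a * q a) • f = 0 := by
      rw [sub_smul, h1 a a rfl, mul_smul, hq, sub_eq_zero]
      have : q a • (f * u a * e (c a) * v a * f) =
        (q a • f) * u a * e (c a) * v a * f := by simp
      rw [this, hq]
      calc _ = f * u a * e (c a) * v a * f * u a * e (c a) * v a * f := by noncomm_ring
        _ = f * u a * e (c a) * v a * (f * f) * u a * e (c a) * v a * f := by rw [hf]
        _ = _ := by noncomm_ring
    have := congrArg m key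
    rw [map_smul, map_zero, smul_eq_mul, sub_mul, mul_assoc, mul_assoc, mul_comm _ (m f),
      mul_cornerForm hf hm] at this
    exact sub_eq_zero.1 this
  -- Summing `h2` gives t q_a = p_a · m f; multiplying by q_a and using `h3` gives t q_a² = q_a².
  have h4 (a : α) : (1 - t) * (q a * q a) = 0 := by
    have : t * q a = m f * p a := by
      rw [htp, Finset.sum_mul, Finset.sum_congr rfl fun b _ => h2 a b, ← Finset.mul_sum, hqs,
        mul_comm]
    have h5 : t * (q a * q a) = q a * q a := by
      rw [← mul_assoc, this, mul_assoc, mul_comm, ← h3, mul_comm (q a * q a), ← mul_assoc,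
        mul_cornerForm hf hm]
    rw [sub_mul, h5, one_mul, sub_self]
  -- Each q_a² is annihilated by 1 - t, so their sum m f lies in the radical of the annihilator, and
  -- being idempotent it lies in the annihilator itself.
  have h6 : (1 - t) * m f = 0 := by
    have mem : m f ∈ (Ideal.radical (LinearMap.ker (LinearMap.mulLeft B (1 - t)))) := by
      rw [← hqs]
      refine Ideal.sum_mem _ fun a _ => ⟨2, ?_⟩
      rw [LinearMap.mem_ker, pow_two]
      exact h4 a
    obtain ⟨N, hN⟩ := mem
    have hidem : IsIdempotentElem (m f) := corner_idem hf hm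
    have : (m f) ^ (N + 1) ∈ (LinearMap.ker (LinearMap.mulLeft B (1 - t))) := by
      rw [pow_succ']
      exact Ideal.mul_mem_left _ _ hN
    rw [hidem.pow_succ_eq] at this
    exact this
  have h7 : m f * t = t := by
    rw [ht, ← smul_eq_mul, ← map_smul, corner_smul_self hf hm]
  rw [sub_mul, one_mul, sub_eq_zero, mul_comm t, h7] at h6
  exact h6.symm

/-- All split systems of an algebra have the same trace functional. -/
theorem splitTrace_eq {ι' α' : Type*} [DecidableEq ι'] [Fintype α'] {c' : α' → ι'} {e' : ι' → T}
    {l' : ι' → T →ₗ[B] B} {u' v' : α' → T} (h' : IsSplitSystem c' e' l' u' v') :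
    splitTrace c e l u v = splitTrace c' e' l' u' v' := by
  ext x
  rw [h'.symmetric_eq_sum _ h.splitTrace_mul_comm, splitTrace_apply]
  refine Finset.sum_congr rfl fun a _ => ?_
  -- Both traces are symmetric, and both take the value l'(e'_i) at e'_i.
  rw [h.splitTrace_corner (h'.idem _) (h'.corner_self _), mul_comm,
    mul_cornerForm (h'.idem _) (h'.corner_self _)]

end IsSplitSystem

end SplitSystem

end CoringTheory
namespace CoringTheory

/-! ### Scalar extension of split systems and descent of the trace -/

section BaseChange

open TensorProduct

variable {R S B B' ι α : Type*} [CommRing R] [Ring S] [Algebra R S] [CommRing B] [Algebra R B]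
  [CommRing B'] [Algebra R B']

/-- The map `B ⊗ S → B' ⊗ S` induced by `φ : B → B'`. -/
abbrev extendScalarsHom (S : Type*) [Ring S] [Algebra R S] (φ : B →ₐ[R] B') :
    B ⊗[R] S →ₐ[R] B' ⊗[R] S :=
  Algebra.TensorProduct.map φ (AlgHom.id R S)

theorem extendScalarsHom_smul (φ : B →ₐ[R] B') (b : B) (x : B ⊗[R] S) :
    extendScalarsHom S φ (b • x) = φ b • extendScalarsHom S φ x := by
  induction x with
  | zero => simp
  | tmul b' s => simp [TensorProduct.smul_tmul']
  | add x y hx hy => rw [smul_add, map_add, hx, hy, map_add, smul_add]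

/-- The functional on `B' ⊗ S` induced by a functional on `B ⊗ S` and `φ : B → B'`. -/
noncomputable def extendScalarsForm (φ : B →ₐ[R] B') (l : B ⊗[R] S →ₗ[B] B) : B' ⊗[R] S →ₗ[B'] B' :=
  (φ.toLinearMap ∘ₗ l.restrictScalars R ∘ₗ TensorProduct.mk R B S 1).liftBaseChange B'

theorem extendScalarsForm_apply (φ : B →ₐ[R] B') (l : B ⊗[R] S →ₗ[B] B) (x : B ⊗[R] S) :
    extendScalarsForm φ l (extendScalarsHom S φ x) = φ (l x) := by
  induction x with
  | zero => simp
  | tmul b s =>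
    rw [← mul_one b, ← smul_eq_mul, ← TensorProduct.smul_tmul', extendScalarsHom_smul, map_smul,
      map_smul]
    simp [extendScalarsForm]
  | add x y hx hy => simp only [map_add, hx, hy]

/-- The image of B ⊗ S spans B' ⊗ S over B', even when `φ` is not surjective. -/
theorem extendScalars_induction (φ : B →ₐ[R] B') {motive : B' ⊗[R] S → Prop} (x : B' ⊗[R] S)
    (smul : ∀ (b : B') (y : B ⊗[R] S), motive (b • extendScalarsHom S φ y))
    (add : ∀ x y, motive x → motive y → motive (x + y)) : motive x := by
  induction x with
  | zero => simpa using smul 0 0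
  | tmul b s => simpa [TensorProduct.smul_tmul'] using smul b (1 ⊗ₜ s)
  | add x y hx hy => exact add x y hx hy

variable [Fintype α] {c : α → ι} {e : ι → B ⊗[R] S}
  {l : ι → B ⊗[R] S →ₗ[B] B} {u v : α → B ⊗[R] S}

theorem splitTrace_extendScalars (φ : B →ₐ[R] B') (x : B ⊗[R] S) :
    splitTrace c (fun i => extendScalarsHom S φ (e i)) (fun i => extendScalarsForm φ (l i))
      (fun a => extendScalarsHom S φ (u a)) (fun a => extendScalarsHom S φ (v a))
      (extendScalarsHom S φ x) = φ (splitTrace c e l u v x) := by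
  rw [splitTrace_apply, splitTrace_apply, map_sum]
  refine Finset.sum_congr rfl fun a _ => ?_
  simp only [cornerForm, LinearMap.smul_apply, ← map_mul, extendScalarsForm_apply, smul_eq_mul]

variable [DecidableEq ι]

theorem IsSplitSystem.extendScalars (h : IsSplitSystem c e l u v) (φ : B →ₐ[R] B') :
    IsSplitSystem c (fun i => extendScalarsHom S φ (e i)) (fun i => extendScalarsForm φ (l i))
      (fun a => extendScalarsHom S φ (u a)) (fun a => extendScalarsHom S φ (v a)) where
  corner i j x := by
    induction x using extendScalars_induction φ with
    | smul b y =>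
      rw [mul_smul_comm, smul_mul_assoc, ← map_mul, ← map_mul, h.corner]
      split_ifs
      · rw [extendScalarsHom_smul, map_smul, extendScalarsForm_apply, smul_smul, smul_eq_mul]
      · simp
    | add x y hx hy =>
      rw [mul_add, add_mul, hx, hy, map_add]
      split_ifs
      · rw [add_smul]
      · simp
  idem i := by rw [← map_mul, h.idem]
  full := by simp only [← map_mul, ← map_sum, h.full, map_one]

/-- Both sides are traces of split systems over `B'`, pushed forward along `φ` and `ψ` and evaluated
at the same 1 ⊗ x, so independence of the trace applies. For the two inclusions of B into B ⊗ B this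
is the descent condition. -/
theorem IsSplitSystem.splitTrace_extendScalars_eq (h : IsSplitSystem c e l u v)
    (φ ψ : B →ₐ[R] B') (x : S) :
    φ (splitTrace c e l u v (1 ⊗ₜ x)) = ψ (splitTrace c e l u v (1 ⊗ₜ x)) := by
  rw [← splitTrace_extendScalars, ← splitTrace_extendScalars,
    (h.extendScalars φ).splitTrace_eq (h.extendScalars ψ)]
  simp

/-- A symmetric nondegenerate functional on `S` descends from a split system over a faithfully flat
extension. -/
theorem IsSplitSystem.exists_symmetric_nondegenerate [Module.FaithfullyFlat R B]
    (h : IsSplitSystem c e l u v) {n : ℕ} {s : Fin n → S} {f : Fin n → S →ₗ[R] R}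
    (hs : ∀ x, ∑ a, f a x • s a = x) :
    ∃ t : S →ₗ[R] R, (∀ x y, t (x * y) = t (y * x)) ∧
      ∀ g : S →ₗ[R] R, ∃ q, ∀ x, t (q * x) = g x := by
  have inj : Function.Injective (algebraMap R B) := FaithfulSMul.algebraMap_injective R B
  -- By faithful flatness, an element of `B` with equal images under the two inclusions into B ⊗ B
  -- comes from `R`.
  have ex (x : S) : ∃ r : R, algebraMap R B r = splitTrace c e l u v (1 ⊗ₜ x) := by
    have := (Algebra.IsEffective.of_faithfullyFlat R B (splitTrace c e l u v (1 ⊗ₜ x))).1 (by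
      rw [Algebra.TensorProduct.includeLeftSubRight_apply, sub_eq_zero]
      exact h.splitTrace_extendScalars_eq (B' := B ⊗[R] B) Algebra.TensorProduct.includeLeft
        Algebra.TensorProduct.includeRight x)
    exact this
  choose r hr using ex
  let t : S →ₗ[R] R :=
    { toFun := r
      map_add' := fun x y => inj (by rw [map_add, hr, hr, hr, TensorProduct.tmul_add, map_add])
      map_smul' := fun a x => inj (by
        rw [RingHom.id_apply, smul_eq_mul, map_mul, hr, hr, ← TensorProduct.smul_tmul,
          Algebra.smul_def, ← smul_eq_mul, ← TensorProduct.smul_tmul', map_smul, smul_eq_mul]) }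
  have ht (x : S) : algebraMap R B (t x) = splitTrace c e l u v (1 ⊗ₜ x) := hr x
  refine ⟨t, fun x y => inj ?_, ?_⟩
  · have (x y : S) : (1 : B) ⊗ₜ[R] (x * y) = (1 ⊗ₜ x) * (1 ⊗ₜ y) := by simp
    rw [ht, ht, this, this, h.splitTrace_mul_comm]
  let Φ : S →ₗ[R] (S →ₗ[R] R) := LinearMap.compRight R t ∘ₗ LinearMap.mul R S
  have hΦ (q x : S) : Φ q x = t (q * x) := rfl
  suffices Function.Surjective Φ by
    intro g
    obtain ⟨q, rfl⟩ := this g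
    exact ⟨q, fun x => rfl⟩
  -- Nondegeneracy is surjectivity of S → S*, which can be checked over `B`, where the trace of the
  -- split system is nondegenerate.
  rw [← Module.FaithfullyFlat.lTensor_surjective_iff_surjective R B]
  let ev (x : S) : B ⊗[R] (S →ₗ[R] R) →ₗ[B] B :=
    (Algebra.linearMap R B ∘ₗ LinearMap.applyₗ x).liftBaseChange B
  have hev (y : B ⊗[R] (S →ₗ[R] R)) : y = ∑ a, ev (s a) y ⊗ₜ f a := by
    induction y with
    | zero => simp
    | tmul b g =>
      have hg : g = ∑ a, g (s a) • f a := by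
        ext x
        conv_lhs => rw [← hs x]
        simp [mul_comm]
      conv_lhs => rw [hg, TensorProduct.tmul_sum]
      refine Finset.sum_congr rfl fun a _ => ?_
      rw [← TensorProduct.smul_tmul]
      simp [ev, Algebra.smul_def, mul_comm]
    | add x y hx hy =>
      conv_lhs => rw [hx, hy]
      simp [TensorProduct.add_tmul, Finset.sum_add_distrib]
  have hevΦ (q : B ⊗[R] S) (x : S) :
      ev x (Φ.lTensor B q) = splitTrace c e l u v (q * 1 ⊗ₜ x) := by
    induction q with
    | zero => simp
    | tmul b y =>
      rw [Algebra.TensorProduct.tmul_mul_tmul, mul_one, LinearMap.lTensor_tmul]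
      conv_rhs => rw [← mul_one b, ← smul_eq_mul, ← TensorProduct.smul_tmul', map_smul, ← ht]
      simp [ev, hΦ]
    | add x y hx hy => rw [map_add, map_add, hx, hy, add_mul, map_add]
  intro y
  -- The functional on B ⊗ S corresponding to y ∈ B ⊗ S*, written through the dual basis.
  let g : B ⊗[R] S →ₗ[B] B :=
    (∑ a, (LinearMap.toSpanSingleton B B (ev (s a) y)).restrictScalars R ∘ₗ
      Algebra.linearMap R B ∘ₗ f a).liftBaseChange B
  obtain ⟨q, hq⟩ := h.exists_splitTrace_mul g
  refine ⟨q, ?_⟩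
  rw [hev (Φ.lTensor B q)]
  conv_rhs => rw [hev y]
  refine Finset.sum_congr rfl fun a _ => ?_
  congr 1
  rw [hevΦ, hq]
  have : ev (s a) y = ∑ b, ev (s b) y * algebraMap R B (f b (s a)) := by
    conv_lhs => rw [hev y]
    simp [ev]
  rw [this]
  simp [g, mul_comm]

end BaseChange

end CoringTheory
namespace CoringTheory

/-! ### The universal split system -/

section Universal

open TensorProduct

/-! ### Coordinates over a base change of a finitely generated projective algebra -/

section Coordinates

variable {R S : Type*} (B : Type*) {B' : Type*} [CommRing R] [Ring S] [Algebra R S] [CommRing B]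
  [Algebra R B] [CommRing B'] [Algebra R B'] {n : ℕ} (s : Fin n → S) (f : Fin n → S →ₗ[R] R)

/-- The coordinate functionals on `B ⊗ S`. -/
noncomputable def scalarCoord (a : Fin n) : B ⊗[R] S →ₗ[B] B :=
  (Algebra.linearMap R B ∘ₗ f a).liftBaseChange B

variable {B}

/-- The element of `B ⊗ S` with given coefficients. -/
noncomputable def ofCoords (b : Fin n → B) : B ⊗[R] S := ∑ a, b a ⊗ₜ s a

/-- The functional on `B ⊗ S` with given coefficients. -/
noncomputable def formOfCoords (b : Fin n → B) : B ⊗[R] S →ₗ[B] B :=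
  ∑ a, b a • scalarCoord B f a

theorem scalarCoord_extend (φ : B →ₐ[R] B') (a : Fin n) (x : B ⊗[R] S) :
    scalarCoord B' f a (extendScalarsHom S φ x) = φ (scalarCoord B f a x) := by
  induction x with
  | zero => simp
  | tmul b y => simp [scalarCoord]
  | add x y hx hy => simp only [map_add, hx, hy]

theorem extend_ofCoords (φ : B →ₐ[R] B') (b : Fin n → B) :
    extendScalarsHom S φ (ofCoords s b) = ofCoords s (φ ∘ b) := by
  simp [ofCoords]

theorem formOfCoords_extend (φ : B →ₐ[R] B') (b : Fin n → B) (x : B ⊗[R] S) :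
    formOfCoords f (φ ∘ b) (extendScalarsHom S φ x) = φ (formOfCoords f b x) := by
  simp [formOfCoords, scalarCoord_extend]

variable {s f} (hs : ∀ x, ∑ a, f a x • s a = x)

include hs

/-- Only this composite is the identity: the s_a generate S but need not be a basis, so an element
has many coordinate vectors. -/
theorem ofCoords_scalarCoord (x : B ⊗[R] S) :
    ofCoords s (fun a => scalarCoord B f a x) = x := by
  induction x with
  | zero => simp [ofCoords]
  | tmul b y =>
    conv_rhs => rw [← hs y, TensorProduct.tmul_sum]
    simp only [ofCoords]
    refine Finset.sum_congr rfl fun a _ => ?_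
    rw [← TensorProduct.smul_tmul, Algebra.smul_def]
    simp [scalarCoord, mul_comm]
  | add x y hx hy =>
    conv_rhs => rw [← hx, ← hy]
    simp [ofCoords, TensorProduct.add_tmul, Finset.sum_add_distrib]

theorem eq_sum_smul (x : B ⊗[R] S) : x = ∑ a, scalarCoord B f a x • ((1 : B) ⊗ₜ[R] s a) := by
  conv_lhs => rw [← ofCoords_scalarCoord hs x]
  simp [ofCoords, TensorProduct.smul_tmul']

theorem formOfCoords_eq (g : B ⊗[R] S →ₗ[B] B) :
    formOfCoords f (fun a => g (1 ⊗ₜ s a)) = g := by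
  ext x
  change formOfCoords f (fun a => g (1 ⊗ₜ s a)) (1 ⊗ₜ x) = g (1 ⊗ₜ x)
  conv_rhs => rw [eq_sum_smul hs ((1 : B) ⊗ₜ[R] x), map_sum]
  simp [formOfCoords, mul_comm]

/-- This turns one equation in B ⊗ S into finitely many equations in `B`. -/
theorem eq_zero_of_scalarCoord (x : B ⊗[R] S) (h : ∀ a, scalarCoord B f a x = 0) : x = 0 := by
  rw [eq_sum_smul hs x]
  simp [h]

end Coordinates

/-! ### The scheme of split systems -/

section Equations

variable {R S : Type*} {B B' : Type*} [CommRing R] [Ring S] [Algebra R S] [CommRing B]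
  [Algebra R B] [CommRing B'] [Algebra R B'] {n : ℕ} (s : Fin n → S) (f : Fin n → S →ₗ[R] R)
  {ι α : Type*} (c : α → ι)

/-- The variables for the coordinates of a split system. -/
abbrev SplitVar (ι α : Type*) (n : ℕ) : Type _ :=
  (ι × Fin n) ⊕ (ι × Fin n) ⊕ (α × Fin n) ⊕ (α × Fin n)

/-- The idempotents with given coordinates. -/
noncomputable def coordE (x : SplitVar ι α n → B) (i : ι) : B ⊗[R] S :=
  ofCoords s fun a => x (.inl (i, a))

/-- The functionals with given coordinates. -/
noncomputable def coordL (x : SplitVar ι α n → B) (i : ι) : B ⊗[R] S →ₗ[B] B :=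
  formOfCoords f fun a => x (.inr (.inl (i, a)))

/-- The left multipliers with given coordinates. -/
noncomputable def coordU (x : SplitVar ι α n → B) (i : α) : B ⊗[R] S :=
  ofCoords s fun a => x (.inr (.inr (.inl (i, a))))

/-- The right multipliers with given coordinates. -/
noncomputable def coordV (x : SplitVar ι α n → B) (i : α) : B ⊗[R] S :=
  ofCoords s fun a => x (.inr (.inr (.inr (i, a))))

variable [DecidableEq ι] [Fintype α]

/-- The coordinates `x` describe a split system. -/
def IsSplitPoint (x : SplitVar ι α n → B) : Prop :=
  IsSplitSystem c (coordE (R := R) s x) (coordL f x) (coordU s x) (coordV s x)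

/-- The coordinate vector with given components. -/
def splitPoint (E L : ι → Fin n → B) (U V : α → Fin n → B) : SplitVar ι α n → B :=
  Sum.elim (fun p => E p.1 p.2) (Sum.elim (fun p => L p.1 p.2)
    (Sum.elim (fun p => U p.1 p.2) (fun p => V p.1 p.2)))

theorem isSplitPoint_splitPoint (E L : ι → Fin n → B) (U V : α → Fin n → B) :
    IsSplitPoint s f c (splitPoint E L U V) ↔ IsSplitSystem c (fun i => ofCoords (R := R) s (E i))
      (fun i => formOfCoords f (L i)) (fun a => ofCoords s (U a)) (fun a => ofCoords s (V a)) :=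
  Iff.rfl

/-- The elements of `B ⊗ S` whose vanishing means that `x` describes a split system. -/
noncomputable def splitDefect (x : SplitVar ι α n → B) :
    (ι × ι × Fin n) ⊕ ι ⊕ Unit → B ⊗[R] S
  | .inl (i, j, a) => coordE s x i * (1 ⊗ₜ s a) * coordE s x j -
      if i = j then coordL f x i (1 ⊗ₜ s a) • coordE s x i else 0
  | .inr (.inl i) => coordE s x i * coordE s x i - coordE s x i
  | .inr (.inr _) => ∑ a, coordU s x a * coordE s x (c a) * coordV s x a - 1

theorem extend_splitDefect (φ : B →ₐ[R] B') (x : SplitVar ι α n → B) (d) :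
    extendScalarsHom S φ (splitDefect s f c x d) = splitDefect s f c (φ ∘ x) d := by
  have hE (i) : extendScalarsHom S φ (coordE s x i) = coordE s (φ ∘ x) i := extend_ofCoords ..
  have hU (i) : extendScalarsHom S φ (coordU s x i) = coordU s (φ ∘ x) i := extend_ofCoords ..
  have hV (i) : extendScalarsHom S φ (coordV s x i) = coordV s (φ ∘ x) i := extend_ofCoords ..
  have hL (i) (y) : φ (coordL f x i y) = coordL f (φ ∘ x) i (extendScalarsHom S φ y) :=
    (formOfCoords_extend ..).symm
  have h1 (y : S) : extendScalarsHom S φ (1 ⊗ₜ y) = 1 ⊗ₜ y := by simp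
  rcases d with ⟨i, j, a⟩ | i | _
  · simp only [splitDefect, map_sub, map_mul, hE, h1]
    split_ifs
    · rw [extendScalarsHom_smul, hL, hE, h1]
    · rw [map_zero]
  · simp only [splitDefect, map_sub, map_mul, hE]
  · simp only [splitDefect, map_sub, map_sum, map_mul, hE, hU, hV, map_one]

variable {s f}

/-- The corner condition is linear in the middle factor, so it suffices to test it on the generators
1 ⊗ s_a. This makes the conditions finite in number when `ι` is finite. -/
theorem isSplitPoint_iff (hs : ∀ x, ∑ a, f a x • s a = x) (x : SplitVar ι α n → B) :
    IsSplitPoint s f c x ↔ ∀ d, splitDefect s f c x d = 0 := by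
  constructor
  · rintro h (⟨i, j, a⟩ | i | _)
    · exact sub_eq_zero.2 (h.corner i j _)
    · exact sub_eq_zero.2 (h.idem i)
    · exact sub_eq_zero.2 h.full
  · intro h
    refine ⟨fun i j y => ?_, fun i => sub_eq_zero.1 (h (.inr (.inl i))),
      sub_eq_zero.1 (h (.inr (.inr ())))⟩
    have h1 (a : Fin n) := sub_eq_zero.1 (h (.inl (i, j, a)))
    rw [eq_sum_smul hs y]
    simp only [Finset.mul_sum, Finset.sum_mul, mul_smul_comm, smul_mul_assoc, h1, map_sum, map_smul]
    split_ifs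
    · rw [Finset.sum_smul]
      simp [mul_smul]
    · simp

theorem IsSplitPoint.map (hs : ∀ x, ∑ a, f a x • s a = x) (φ : B →ₐ[R] B') {x : SplitVar ι α n → B}
    (h : IsSplitPoint s f c x) : IsSplitPoint s f c (φ ∘ x) := by
  rw [isSplitPoint_iff c hs] at h ⊢
  intro d
  rw [← extend_splitDefect, h, map_zero]

theorem IsSplitSystem.exists_isSplitPoint (hs : ∀ x, ∑ a, f a x • s a = x) {e : ι → B ⊗[R] S}
    {l : ι → B ⊗[R] S →ₗ[B] B} {u v : α → B ⊗[R] S} (h : IsSplitSystem c e l u v) :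
    ∃ x : SplitVar ι α n → B, IsSplitPoint s f c x := by
  refine ⟨splitPoint (fun i a => scalarCoord B f a (e i)) (fun i a => l i (1 ⊗ₜ s a))
    (fun i a => scalarCoord B f a (u i)) (fun i a => scalarCoord B f a (v i)), ?_⟩
  simpa only [isSplitPoint_splitPoint, ofCoords_scalarCoord hs, formOfCoords_eq hs] using h

variable (s f)

/-- The ideal of the equations of split systems. -/
noncomputable def splitIdeal : Ideal (MvPolynomial (SplitVar ι α n) R) :=
  Ideal.span (Set.range fun p : ((ι × ι × Fin n) ⊕ ι ⊕ Unit) × Fin n =>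
    scalarCoord _ f p.2 (splitDefect s f c MvPolynomial.X p.1))

/-- The coordinate ring of the scheme of split systems. -/
abbrev SplitRing : Type _ := MvPolynomial (SplitVar ι α n) R ⧸ splitIdeal s f c

/-- The universal split system. -/
noncomputable def splitUniv : SplitVar ι α n → SplitRing s f c :=
  fun i => Ideal.Quotient.mkₐ R (splitIdeal s f c) (MvPolynomial.X i)

variable {s f}

theorem isSplitPoint_splitUniv (hs : ∀ x, ∑ a, f a x • s a = x) :
    IsSplitPoint s f c (splitUniv s f c) := by
  rw [isSplitPoint_iff c hs]
  intro d
  have : splitUniv s f c = Ideal.Quotient.mkₐ R (splitIdeal s f c) ∘ MvPolynomial.X := rfl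
  rw [this, ← extend_splitDefect]
  refine eq_zero_of_scalarCoord hs _ fun a => ?_
  rw [scalarCoord_extend]
  exact Ideal.Quotient.eq_zero_iff_mem.2 (Ideal.subset_span ⟨(d, a), rfl⟩)

/-- Evaluation of the variables at x kills the generators of the ideal, since these are the
coordinates of the universal defects and defects commute with base change. -/
theorem IsSplitPoint.exists_algHom (hs : ∀ x, ∑ a, f a x • s a = x) {x : SplitVar ι α n → B}
    (h : IsSplitPoint s f c x) : ∃ φ : SplitRing s f c →ₐ[R] B, φ ∘ splitUniv s f c = x := by
  refine ⟨Ideal.Quotient.liftₐ _ (MvPolynomial.aeval x) fun p hp => ?_, ?_⟩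
  · have : splitIdeal s f c ≤ RingHom.ker (MvPolynomial.aeval (R := R) x) := by
      refine Ideal.span_le.2 ?_
      rintro _ ⟨⟨d, a⟩, rfl⟩
      change MvPolynomial.aeval x _ = 0
      rw [← scalarCoord_extend, extend_splitDefect]
      have h1 : (MvPolynomial.aeval (R := R) x : _ → B) ∘ MvPolynomial.X = x := by ext; simp
      rw [h1, (isSplitPoint_iff c hs x).1 h, map_zero]
    exact this hp
  · ext i
    change MvPolynomial.aeval x (MvPolynomial.X i) = x i
    simp

theorem splitRing_hom_ext {φ ψ : SplitRing s f c →ₐ[R] B}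
    (h : φ ∘ splitUniv s f c = ψ ∘ splitUniv s f c) : φ = ψ := by
  refine Ideal.Quotient.algHom_ext _ (MvPolynomial.algHom_ext fun i => ?_)
  exact congrFun h i

end Equations

/-! ### Infinitesimal lifting of split systems -/

section Lifting

variable {R S : Type*} {B B' : Type*} [CommRing R] [Ring S] [Algebra R S] [CommRing B]
  [Algebra R B] [CommRing B'] [Algebra R B'] {n : ℕ} {s : Fin n → S} {f : Fin n → S →ₗ[R] R}
  {φ : B →ₐ[R] B'}

theorem extend_surjective (hφ : Function.Surjective φ) :
    Function.Surjective (extendScalarsHom S φ) := by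
  intro x
  induction x using extendScalars_induction φ with
  | smul b y =>
    obtain ⟨b, rfl⟩ := hφ b
    exact ⟨b • y, extendScalarsHom_smul ..⟩
  | add x y hx hy =>
    obtain ⟨x, rfl⟩ := hx
    obtain ⟨y, rfl⟩ := hy
    exact ⟨x + y, map_add ..⟩

variable (hs : ∀ x, ∑ a, f a x • s a = x)

include hs

/-- Coordinates are not unique, so a naive lift of `b` may represent another element than `y`. The
difference maps to 0, hence so do its canonical coordinates, and adding them corrects the element
without changing the reduction `b`. -/
theorem exists_ofCoords_eq (hφ : Function.Surjective φ) {y : B ⊗[R] S} {b : Fin n → B'}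
    (h : extendScalarsHom S φ y = ofCoords s b) : ∃ b₀ : Fin n → B, φ ∘ b₀ = b ∧
      ofCoords (R := R) s b₀ = y := by
  choose g hg using hφ
  let w := y - ofCoords (R := R) s (g ∘ b)
  have hb : φ ∘ g ∘ b = b := by ext; simp [hg]
  have hw : extendScalarsHom S φ w = 0 := by
    rw [map_sub, h, extend_ofCoords, hb, sub_self]
  refine ⟨fun a => g (b a) + scalarCoord B f a w, ?_, ?_⟩
  · ext a
    simp [← scalarCoord_extend, hw, hg]
  · have : ofCoords s (fun a => g (b a) + scalarCoord B f a w) =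
        ofCoords (R := R) s (g ∘ b) + ofCoords (R := R) s (fun a => scalarCoord B f a w) := by
      simp [ofCoords, TensorProduct.add_tmul, Finset.sum_add_distrib]
    rw [this, ofCoords_scalarCoord hs]
    simp [w]

theorem smul_eq_zero_of_extend (hker : ∀ x y, φ x = 0 → φ y = 0 → x * y = 0) {b : B}
    {w : B ⊗[R] S} (hb : φ b = 0) (hw : extendScalarsHom S φ w = 0) : b • w = 0 := by
  refine eq_zero_of_scalarCoord hs _ fun a => ?_
  rw [map_smul, smul_eq_mul]
  refine hker _ _ hb ?_
  rw [← scalarCoord_extend, hw, map_zero]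

theorem mul_eq_zero_of_extend (hker : ∀ x y, φ x = 0 → φ y = 0 → x * y = 0)
    {w w' : B ⊗[R] S} (hw : extendScalarsHom S φ w = 0) (hw' : extendScalarsHom S φ w' = 0) :
    w * w' = 0 := by
  rw [eq_sum_smul hs w, Finset.sum_mul]
  refine Finset.sum_eq_zero fun a _ => ?_
  rw [smul_mul_assoc]
  refine smul_eq_zero_of_extend hs hker ?_ ?_
  · rw [← scalarCoord_extend, hw, map_zero]
  · rw [map_mul, hw', mul_zero]

/-- Split systems lift along square-zero extensions. -/
theorem IsSplitPoint.exists_lift {ι α : Type*} [Finite ι] [DecidableEq ι] [Fintype α] {c : α → ι}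
    (hφ : Function.Surjective φ) (hker : ∀ x y, φ x = 0 → φ y = 0 → x * y = 0)
    {x : SplitVar ι α n → B'} (h : IsSplitPoint s f c x) :
    ∃ y : SplitVar ι α n → B, φ ∘ y = x ∧ IsSplitPoint s f c y := by
  set Φ := extendScalarsHom S φ with hΦ
  have hΦs : Function.Surjective Φ := extend_surjective hφ
  -- The corner condition with middle factor 1 gives orthogonality, and orthogonal idempotents lift
  -- together along a nil kernel.
  have orth : OrthogonalIdempotents (coordE (R := R) s x) := by
    refine ⟨h.idem, fun i j hij => ?_⟩
    have := h.corner i j 1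
    rwa [mul_one, if_neg hij] at this
  obtain ⟨e, he, hΦe⟩ := OrthogonalIdempotents.lift_of_isNilpotent_ker (Φ : B ⊗[R] S →+* B' ⊗[R] S)
    (fun w hw => ⟨2, by rw [pow_two]; exact mul_eq_zero_of_extend hs hker hw hw⟩) orth
    (fun i => hΦs _)
  replace hΦe (i : ι) : Φ (e i) = coordE s x i := congrFun hΦe i
  have idem (i : ι) : e i * e i = e i := he.idem i
  have eE (i : ι) := exists_ofCoords_eq hs hφ (hΦe i)
  choose E hE hEe using eE
  have hl (i : ι) : ∃ L : Fin n → B, φ ∘ L = (fun a => x (.inr (.inl (i, a)))) ∧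
      ∀ y, e i * y * e i = formOfCoords f L y • e i := by
    choose g hg using hφ
    let L₀ : Fin n → B := fun a => g (x (.inr (.inl (i, a))))
    let l₀ := formOfCoords f L₀
    have hL₀ : φ ∘ L₀ = fun a => x (.inr (.inl (i, a))) := by ext; simp [L₀, hg]
    let D : B ⊗[R] S →ₗ[B] B ⊗[R] S :=
      LinearMap.mulRight B (e i) ∘ₗ LinearMap.mulLeft B (e i) - l₀.smulRight (e i)
    have hD (y) : D y = e i * y * e i - l₀ y • e i := by simp [D]
    have hΦD (y) : Φ (D y) = 0 := by
      rw [hD, map_sub, map_mul, map_mul, hΦe, h.corner_self, extendScalarsHom_smul, sub_eq_zero,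
        ← hΦ, hΦe]
      congr 1
      rw [← formOfCoords_extend, hL₀]
      rfl
    -- D measures the failure of the naive lift l₀. Since D y lies in the corner e B⊗S e, it equals
    -- Σ coord_a(D y) · e s_a e with e s_a e = D(s_a) + l₀(s_a) e; the terms with D(s_a) vanish by
    -- square-zero. Hence D y = δ(y) e and l₀ + δ is an exact lift.
    let δ : B ⊗[R] S →ₗ[B] B := ∑ a, l₀ (1 ⊗ₜ s a) • (scalarCoord B f a ∘ₗ D)
    have hφδ (y) : φ (δ y) = 0 := by simp [δ, ← scalarCoord_extend, ← hΦ, hΦD]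
    refine ⟨fun a => L₀ a + δ (1 ⊗ₜ s a), ?_, fun y => ?_⟩
    · ext a
      simp [L₀, hg, hφδ]
    · have h1 : formOfCoords f (fun a => L₀ a + δ (1 ⊗ₜ s a)) = l₀ + δ := by
        conv_rhs => rw [← formOfCoords_eq hs δ]
        simp [l₀, formOfCoords, add_smul, Finset.sum_add_distrib]
      have h2 : e i * D y * e i = D y := by
        rw [hD, mul_sub, sub_mul, mul_smul_comm, smul_mul_assoc, idem, idem, ← mul_assoc,
          ← mul_assoc, idem, mul_assoc _ _ (e i), idem]
      have h3 : D y = δ y • e i := by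
        conv_lhs => rw [← h2, eq_sum_smul hs (D y)]
        simp only [Finset.mul_sum, Finset.sum_mul, δ, LinearMap.sum_apply, Finset.sum_smul]
        refine Finset.sum_congr rfl fun a _ => ?_
        have h4 : e i * (1 ⊗ₜ s a) * e i = D (1 ⊗ₜ s a) + l₀ (1 ⊗ₜ s a) • e i := by
          rw [hD, sub_add_cancel]
        rw [mul_smul_comm, smul_mul_assoc, h4, smul_add,
          smul_eq_zero_of_extend hs hker _ (hΦD _), zero_add]
        · simp [smul_smul, mul_comm]
        · rw [← scalarCoord_extend, ← hΦ, hΦD, map_zero]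
      rw [h1, LinearMap.add_apply, add_smul, ← h3, hD]
      abel
  choose L hL hLe using hl
  have hU (a : α) : ∃ b : Fin n → B, φ ∘ b = fun k => x (.inr (.inr (.inl (a, k)))) := by
    choose g hg using hφ
    exact ⟨fun k => g _, by ext; exact hg _⟩
  choose U hU using hU
  have hUu (a : α) : Φ (ofCoords s (U a)) = coordU s x a := by
    rw [hΦ, extend_ofCoords, hU]; rfl
  choose v hv using fun a => hΦs (coordV s x a)
  let w := ∑ a, ofCoords s (U a) * e (c a) * v a
  have hw : Φ (1 - w) = 0 := by
    simp only [w, map_sub, map_sum, map_mul, hΦe, hUu, hv, map_one]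
    rw [sub_eq_zero]
    exact h.full.symm
  have hw1 : w * (2 - w) = 1 := by
    -- As 1 - w lies in the square-zero kernel, w has inverse 2 - w; multiplying the v_a by it
    -- restores Σ u e v = 1 without changing their reductions.
    have := mul_eq_zero_of_extend hs hker hw hw
    have h5 : w * (2 - w) = 1 - (1 - w) * (1 - w) := by noncomm_ring
    rw [h5, this, sub_zero]
  have hΦw : Φ (2 - w) = 1 := by
    have : (2 : B ⊗[R] S) - w = 1 + (1 - w) := by
      rw [← one_add_one_eq_two, add_sub_assoc]
    rw [this, map_add, hw, map_one, add_zero]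
  have eV (a : α) : ∃ b : Fin n → B, φ ∘ b = (fun k => x (.inr (.inr (.inr (a, k))))) ∧
      ofCoords s b = v a * (2 - w) :=
    exists_ofCoords_eq hs hφ (by rw [map_mul, ← hΦ, hΦw, mul_one, hv]; rfl)
  choose V hV hVv using eV
  refine ⟨splitPoint E L U V, ?_, ?_⟩
  · ext (⟨i, a⟩ | ⟨i, a⟩ | ⟨i, a⟩ | ⟨i, a⟩)
    · exact congrFun (hE i) a
    · exact congrFun (hL i) a
    · exact congrFun (hU i) a
    · exact congrFun (hV i) a
  · rw [isSplitPoint_splitPoint]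
    simp only [hEe, hVv]
    refine ⟨fun i j y => ?_, idem, ?_⟩
    · split_ifs with hij
      · rw [← hij, hLe]
      · have hz (y) : Φ (e i * y * e j) = 0 := by
          rw [map_mul, map_mul, hΦe, hΦe, h.corner, if_neg hij]
        -- Sandwiching an element of the kernel once more expands it as a sum of products of two
        -- kernel factors, so the strong orthogonality persists.
        have h2 : e i * (e i * y * e j) * e j = e i * y * e j := by
          rw [← mul_assoc, ← mul_assoc, idem, mul_assoc _ _ (e j), idem]
        rw [← h2, eq_sum_smul hs (e i * y * e j), Finset.mul_sum, Finset.sum_mul]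
        refine Finset.sum_eq_zero fun a _ => ?_
        rw [mul_smul_comm, smul_mul_assoc]
        refine smul_eq_zero_of_extend hs hker ?_ (hz _)
        rw [← scalarCoord_extend, ← hΦ, hz, map_zero]
    · rw [← hw1, Finset.sum_mul]
      simp only [mul_assoc]

end Lifting

/-! ### Smoothness of the scheme of split systems -/

section Smooth

variable {R : Type u} {S : Type*} [CommRing R] [Ring S] [Algebra R S] {n : ℕ} {s : Fin n → S}
  {f : Fin n → S →ₗ[R] R} {ι : Type v} {α : Type w} [Finite ι] [DecidableEq ι] [Fintype α]
  (c : α → ι)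

/-- Algebra maps out of `SplitRing` are the same as split points, so the infinitesimal criterion is
the lifting of split systems. -/
theorem formallySmooth_splitRing (hs : ∀ x, ∑ a, f a x • s a = x) :
    Algebra.FormallySmooth R (SplitRing s f c) := by
  refine Algebra.FormallySmooth.of_comp_surjective fun B _ _ I hI g => ?_
  have hker (x y : B) (hx : Ideal.Quotient.mkₐ R I x = 0) (hy : Ideal.Quotient.mkₐ R I y = 0) :
      x * y = 0 := by
    have := Ideal.mul_mem_mul (Ideal.Quotient.eq_zero_iff_mem.1 hx)
      (Ideal.Quotient.eq_zero_iff_mem.1 hy)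
    rwa [← pow_two, hI] at this
  obtain ⟨y, hy, hy'⟩ := ((isSplitPoint_splitUniv c hs).map c hs g).exists_lift hs
    (Ideal.Quotient.mkₐ_surjective R I) hker
  obtain ⟨φ, hφ⟩ := hy'.exists_algHom c hs
  refine ⟨φ, splitRing_hom_ext c ?_⟩
  rw [← hy, ← hφ]
  rfl

theorem smooth_splitRing (hs : ∀ x, ∑ a, f a x • s a = x) :
    Algebra.Smooth R (SplitRing s f c) where
  formallySmooth := formallySmooth_splitRing c hs
  finitePresentation := by
    cases nonempty_fintype ι
    exact Algebra.FinitePresentation.quotient (Submodule.fg_span (Set.finite_range _))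

end Smooth

end Universal

end CoringTheory
namespace CoringTheory

/-! ### Separable algebras are symmetric Frobenius algebras -/

section Separable

open TensorProduct

/-- An `R`-algebra `S` is separable if `S ⊗ S` contains a separability idempotent. -/
def IsSeparableAlgebra (R S : Type*) [CommRing R] [Ring S] [Algebra R S] : Prop :=
  ∃ e : S ⊗[R] S, LinearMap.mul' R S e = 1 ∧
    ∀ x, (LinearMap.mulLeft R x).rTensor S e = (LinearMap.mulRight R x).lTensor S e

/-- The new idempotent is the image of the old one under x ⊗ y ↦ (1 ⊗ x) ⊗ (1 ⊗ y). -/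
theorem IsSeparableAlgebra.baseChange {R S : Type*} (B : Type*) [CommRing R] [Ring S] [Algebra R S]
    [CommRing B] [Algebra R B] (h : IsSeparableAlgebra R S) : IsSeparableAlgebra B (B ⊗[R] S) := by
  obtain ⟨e, he, hx⟩ := h
  let i : S →ₗ[R] B ⊗[R] S := TensorProduct.mk R B S 1
  let θ : S ⊗[R] S →ₗ[R] (B ⊗[R] S) ⊗[B] (B ⊗[R] S) := TensorProduct.lift
    ((((TensorProduct.mk B (B ⊗[R] S) (B ⊗[R] S)).restrictScalars₁₂ R R).compl₁₂ i i))
  have hθ (x y : S) : θ (x ⊗ₜ y) = (1 ⊗ₜ x) ⊗ₜ (1 ⊗ₜ y) := rfl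
  refine ⟨θ e, ?_, fun x => ?_⟩
  · have (w : S ⊗[R] S) : LinearMap.mul' B (B ⊗[R] S) (θ w) = 1 ⊗ₜ (LinearMap.mul' R S w) := by
      induction w with
      | zero => simp
      | tmul x y => simp [hθ]
      | add x y hx hy => simp only [map_add, hx, hy, TensorProduct.tmul_add]
    rw [this, he]; rfl
  · induction x with
    | zero => simp
    | tmul b s =>
      have h1 : b ⊗ₜ[R] s = b • ((1 : B) ⊗ₜ[R] s) := by simp [TensorProduct.smul_tmul']
      have hl (w : S ⊗[R] S) : (LinearMap.mulLeft B ((1 : B) ⊗ₜ[R] s)).rTensor (B ⊗[R] S) (θ w) =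
          θ ((LinearMap.mulLeft R s).rTensor S w) := by
        induction w with
        | zero => simp
        | tmul x y => simp [hθ]
        | add x y hx hy => simp only [map_add, hx, hy]
      have hr (w : S ⊗[R] S) : (LinearMap.mulRight B ((1 : B) ⊗ₜ[R] s)).lTensor (B ⊗[R] S) (θ w) =
          θ ((LinearMap.mulRight R s).lTensor S w) := by
        induction w with
        | zero => simp
        | tmul x y => simp [hθ]
        | add x y hx hy => simp only [map_add, hx, hy]
      have h2 : LinearMap.mulLeft B (b • ((1 : B) ⊗ₜ[R] s)) = b • LinearMap.mulLeft B (1 ⊗ₜ[R] s) := by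
        ext; simp
      have h3 : LinearMap.mulRight B (b • ((1 : B) ⊗ₜ[R] s)) =
          b • LinearMap.mulRight B (1 ⊗ₜ[R] s) := by
        ext; simp
      rw [h1, h2, h3, LinearMap.rTensor_smul, LinearMap.lTensor_smul, LinearMap.smul_apply,
        LinearMap.smul_apply, hl, hr, hx]
    | add x y hx hy =>
      have h2 : LinearMap.mulLeft B (x + y) = LinearMap.mulLeft B x + LinearMap.mulLeft B y := by
        ext; simp [add_mul]
      have h3 : LinearMap.mulRight B (x + y) = LinearMap.mulRight B x + LinearMap.mulRight B y := by
        ext; simp [mul_add]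
      rw [h2, h3, LinearMap.rTensor_add, LinearMap.lTensor_add, LinearMap.add_apply,
        LinearMap.add_apply, hx, hy]

/-- A separable algebra over a field is semisimple. -/
theorem IsSeparableAlgebra.isSemisimpleRing {k T : Type*} [Field k] [Ring T] [Algebra k T]
    (h : IsSeparableAlgebra k T) : IsSemisimpleRing T := by
  obtain ⟨e, he, hx⟩ := h
  suffices ComplementedLattice (Submodule T T) from { this with }
  refine ⟨fun N => ?_⟩
  obtain ⟨p, hp⟩ := (N.restrictScalars k).subtype.exists_leftInverse_of_injective
    (Submodule.ker_subtype _)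
  let p₀ : T →ₗ[k] N := p
  have hp₀ (x : N) : p₀ x = x := LinearMap.congr_fun hp x
  let q (m : T) : T ⊗[k] T →ₗ[k] N := TensorProduct.lift
    (LinearMap.mk₂ k (fun x y : T => x • p₀ (y * m)) (fun x x' y => add_smul ..)
      (fun a x y => smul_assoc ..) (fun x y y' => by rw [add_mul, map_add, smul_add])
      (fun a x y => by rw [smul_mul_assoc, map_smul, smul_comm]))
  have hq (m x y : T) : q m (x ⊗ₜ y) = x • p₀ (y * m) := rfl
  -- Maschke averaging: for e = Σ x_i ⊗ y_i, the map m ↦ Σ x_i p(y_i m) is T-linear because e is a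
  -- Casimir element, and fixes N because Σ x_i y_i = 1.
  let P : T →ₗ[T] N :=
    { toFun := fun m => q m e
      map_add' := fun m m' => by
        have (w : T ⊗[k] T) : q (m + m') w = q m w + q m' w := by
          induction w with
          | zero => simp
          | tmul x y => simp only [hq, mul_add, map_add, smul_add]
          | add x y hx hy => rw [map_add, map_add, map_add, hx, hy]; abel
        exact this e
      map_smul' := fun r m => by
        have h1 (w : T ⊗[k] T) : q (r * m) w = q m ((LinearMap.mulRight k r).lTensor T w) := by
          induction w with
          | zero => simp
          | tmul x y => simp [hq, mul_assoc]
          | add x y hx hy => simp only [map_add, hx, hy]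
        have h2 (w : T ⊗[k] T) : r • q m w = q m ((LinearMap.mulLeft k r).rTensor T w) := by
          induction w with
          | zero => simp
          | tmul x y => simp [hq, mul_smul]
          | add x y hx hy => simp only [map_add, smul_add, hx, hy]
        rw [smul_eq_mul, h1, ← hx, ← h2]; rfl }
  refine ⟨LinearMap.ker P, LinearMap.isCompl_of_proj fun x => Subtype.ext ?_⟩
  have (w : T ⊗[k] T) : (q x w : T) = LinearMap.mul' k T w * x := by
    induction w with
    | zero => simp
    | tmul y z =>
      have : z * (x : T) = ((z • x : N) : T) := rfl
      rw [hq, this, hp₀]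
      simp [mul_assoc]
    | add y z hy hz => simp only [map_add, Submodule.coe_add, hy, hz, add_mul]
  change (q x e : T) = x
  rw [this, he, one_mul]

/-! ### The standard split system of a product of matrix algebras -/

section Matrix

variable {k : Type*} [CommRing k] {r : ℕ} (d : Fin r → ℕ) [∀ i, NeZero (d i)]

/-- In each block one has E_00 X E_00 = X_00 E_00 and 1 = Σ_a E_a0 E_00 E_0a; nonzero sizes ensure
that the index 0 exists. -/
theorem isSplitSystem_matrix : IsSplitSystem
    (T := Π i, Matrix (Fin (d i)) (Fin (d i)) k) (B := k)
    (Sigma.fst : (Σ i, Fin (d i)) → Fin r)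
    (fun i => Pi.single i (Matrix.single 0 0 1))
    (fun i => Matrix.entryLinearMap k k 0 0 ∘ₗ LinearMap.proj i)
    (fun a => Pi.single a.1 (Matrix.single a.2 0 1))
    (fun a => Pi.single a.1 (Matrix.single 0 a.2 1)) where
  corner i j x := by
    split_ifs with hij
    · subst hij
      ext m p q
      by_cases hm : m = i
      · subst hm
        simp [Matrix.single_mul_mul_single, Matrix.single_apply]
      · simp [hm]
    · ext m p q
      by_cases hm : m = i
      · subst hm
        simp [hij]
      · simp [hm]
  idem i := by
    rw [← Pi.single_mul]; simp
  full := by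
    rw [Fintype.sum_sigma]
    ext m p q
    simp only [← Pi.single_mul, Matrix.single_mul_single_same, mul_one, Finset.sum_apply]
    rw [Finset.sum_eq_single m]
    · simp [Matrix.one_apply, Matrix.sum_apply, Matrix.single_apply]
      by_cases hpq : p = q
      · simp [hpq, Finset.filter_eq']
      · have : ({x | x = p ∧ x = q} : Finset (Fin (d m))) = ∅ :=
          Finset.filter_eq_empty_iff.2 fun x _ hx => hpq (hx.1.symm.trans hx.2)
        simp [this, hpq]
    · intro i _ hi
      simp [Pi.single_eq_of_ne' hi]
    · simp

end Matrix

/-! ### Transport and padding of split systems -/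

section Transport

variable {B T T' ι ι' α α' : Type*} [CommRing B] [Ring T] [Algebra B T] [Ring T'] [Algebra B T']
  [DecidableEq ι] [Fintype α] [DecidableEq ι'] [Fintype α'] {c : α → ι} {e : ι → T}
  {l : ι → T →ₗ[B] B} {u v : α → T}

theorem IsSplitSystem.mapEquiv (h : IsSplitSystem c e l u v) (g : T ≃ₐ[B] T') :
    IsSplitSystem c (fun i => g (e i)) (fun i => l i ∘ₗ g.symm.toLinearMap) (fun a => g (u a))
      (fun a => g (v a)) where
  corner i j x := by
    obtain ⟨x, rfl⟩ := g.surjective x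
    rw [← map_mul, ← map_mul, h.corner]
    split_ifs <;> simp
  idem i := by rw [← map_mul, h.idem]
  full := by simp only [← map_mul, ← map_sum, h.full, map_one]

open Function in
/-- Split systems can be padded by zeros. -/
theorem IsSplitSystem.extend (h : IsSplitSystem c e l u v) {p : ι → ι'} {q : α → α'}
    (hp : Injective p) (hq : Injective q) {c' : α' → ι'} (hc : ∀ a, c' (q a) = p (c a)) :
    IsSplitSystem c' (extend p e 0) (extend p l 0) (extend q u 0) (extend q v 0) where
  corner i j x := by
    by_cases hi : ∃ a, p a = i
    · obtain ⟨i, rfl⟩ := hi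
      by_cases hj : ∃ a, p a = j
      · obtain ⟨j, rfl⟩ := hj
        simp [hp.extend_apply, h.corner, hp.eq_iff]
      · have : p i ≠ j := fun hij => hj ⟨i, hij⟩
        simp [extend_apply' _ _ _ hj, this]
    · simp [extend_apply' _ _ _ hi]
  idem i := by
    by_cases hi : ∃ a, p a = i
    · obtain ⟨i, rfl⟩ := hi
      simp [hp.extend_apply, h.idem]
    · simp [extend_apply' _ _ _ hi]
  full := by
    rw [← h.full]
    refine (Fintype.sum_of_injective q hq _ _ (fun a ha => ?_) fun a => ?_).symm
    · rw [extend_apply' _ _ _ (by simpa using ha)]; simp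
    · simp [hq.extend_apply, hp.extend_apply, hc]

end Transport

/-! ### Geometric points and faithful flatness -/

variable {R S : Type*} [CommRing R] [Ring S] [Algebra R S] {n : ℕ} {s : Fin n → S}
  {f : Fin n → S →ₗ[R] R}

/-- Wedderburn's theorem splits the fiber. Its dimension is at most n, which bounds both the number
and the sizes of the blocks, so padding by zeros fits every fiber into the same index sets `Fin n`
and `Fin n × Fin n`. -/
theorem exists_isSplitPoint_of_isAlgClosed (hs : ∀ x, ∑ a, f a x • s a = x)
    (hS : IsSeparableAlgebra R S) (k : Type*) [Field k] [IsAlgClosed k] [Algebra R k] :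
    ∃ x : SplitVar (Fin n) (Fin n × Fin n) n → k, IsSplitPoint s f Prod.fst x := by
  have span : Submodule.span k (Set.range fun a => (1 : k) ⊗ₜ[R] s a) = ⊤ := by
    rw [eq_top_iff]
    rintro x -
    rw [eq_sum_smul hs x]
    exact Submodule.sum_mem _ fun a _ => Submodule.smul_mem _ _ (Submodule.subset_span ⟨a, rfl⟩)
  have fin : Module.Finite k (k ⊗[R] S) :=
    Module.finite_def.2 (span ▸ Submodule.fg_span (Set.finite_range _))
  have := (hS.baseChange k).isSemisimpleRing
  obtain ⟨r, d, hd, ⟨g⟩⟩ :=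
    IsSemisimpleRing.exists_algEquiv_pi_matrix_of_isAlgClosed k (k ⊗[R] S)
  have rank : ∑ i, d i * d i ≤ n := by
    calc ∑ i, d i * d i = Module.finrank k (Π i, Matrix (Fin (d i)) (Fin (d i)) k) := by
          rw [Module.finrank_pi_fintype]
          simp [Module.finrank_matrix]
      _ = Module.finrank k (k ⊗[R] S) := g.toLinearEquiv.finrank_eq.symm
      _ ≤ n := by
          rw [← finrank_top, ← span]
          simpa [Set.finrank] using finrank_range_le_card (R := k) (fun a => (1 : k) ⊗ₜ[R] s a)
  have hd' (i : Fin r) : 1 ≤ d i := Nat.one_le_iff_ne_zero.2 (hd i).out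
  have hr : r ≤ n := by
    refine le_trans ?_ rank
    calc r = ∑ i : Fin r, 1 := by simp
      _ ≤ _ := Finset.sum_le_sum fun i _ => Nat.mul_le_mul (hd' i) (hd' i)
  have hdn (i : Fin r) : d i ≤ n :=
    (Nat.le_mul_self _).trans ((Finset.single_le_sum (f := fun i => d i * d i)
      (fun _ _ => Nat.zero_le _) (Finset.mem_univ i)).trans rank)
  have h := ((isSplitSystem_matrix (k := k) d).mapEquiv g.symm).extend (ι' := Fin n)
    (α' := Fin n × Fin n) (p := Fin.castLE hr)
    (q := fun a => (Fin.castLE hr a.1, Fin.castLE (hdn a.1) a.2)) (c' := Prod.fst)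
    (Fin.castLE_injective hr) (by
      rintro ⟨i, a⟩ ⟨j, b⟩ hab
      obtain ⟨h1, h2⟩ := Prod.mk.inj hab
      obtain rfl := Fin.castLE_injective hr h1
      obtain rfl := Fin.castLE_injective (hdn i) h2
      rfl) (fun _ => rfl)
  exact h.exists_isSplitPoint _ hs

/-- Smoothness gives flatness. A point over an algebraic closure of the residue field at m shows
that m does not generate the unit ideal. -/
theorem faithfullyFlat_splitRing (hs : ∀ x, ∑ a, f a x • s a = x) (hS : IsSeparableAlgebra R S) :
    Module.FaithfullyFlat R (SplitRing s f (Prod.fst : Fin n × Fin n → Fin n)) := by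
  have := smooth_splitRing (Prod.fst : Fin n × Fin n → Fin n) hs
  have : Module.Flat R (SplitRing s f (Prod.fst : Fin n × Fin n → Fin n)) :=
    Algebra.Smooth.flat R _
  refine ⟨fun m hm htop => ?_⟩
  let _ := Ideal.Quotient.field m
  let k := AlgebraicClosure (R ⧸ m)
  obtain ⟨x, hx⟩ := exists_isSplitPoint_of_isAlgClosed hs hS k
  obtain ⟨φ, -⟩ := hx.exists_algHom _ hs
  have h1 : (1 : SplitRing s f (Prod.fst : Fin n × Fin n → Fin n)) ∈
      m.map (algebraMap R (SplitRing s f (Prod.fst : Fin n × Fin n → Fin n))) := by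
    have : (1 : SplitRing s f (Prod.fst : Fin n × Fin n → Fin n)) ∈
      m • (⊤ : Submodule R (SplitRing s f (Prod.fst : Fin n × Fin n → Fin n))) := by
      rw [htop]; trivial
    rwa [Ideal.smul_top_eq_map] at this
  have h2 : m.map (algebraMap R (SplitRing s f (Prod.fst : Fin n × Fin n → Fin n))) ≤
      RingHom.ker φ := by
    refine Ideal.map_le_iff_le_comap.2 fun a ha => ?_
    change φ (algebraMap R _ a) = 0
    rw [AlgHom.commutes, IsScalarTower.algebraMap_apply R (R ⧸ m) k,
      Ideal.Quotient.algebraMap_eq, Ideal.Quotient.eq_zero_iff_mem.2 ha, map_zero]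
  exact one_ne_zero ((map_one φ).symm.trans (h2 h1))

/-- A separable algebra over a commutative ring that is a finitely generated projective module
carries a symmetric nondegenerate functional. -/
theorem IsSeparableAlgebra.exists_symmetric_nondegenerate (hs : ∀ x, ∑ a, f a x • s a = x)
    (hS : IsSeparableAlgebra R S) : ∃ t : S →ₗ[R] R, (∀ x y, t (x * y) = t (y * x)) ∧
      ∀ g : S →ₗ[R] R, ∃ q, ∀ x, t (q * x) = g x := by
  have := faithfullyFlat_splitRing hs hS
  exact IsSplitSystem.exists_symmetric_nondegenerate
    (isSplitPoint_splitUniv (Prod.fst : Fin n × Fin n → Fin n) hs) hs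

end Separable

end CoringTheory
namespace CoringTheory

/-! ### The convolution ring of bimodule functionals on a coring -/

namespace BimodHom

variable {A : Type*} [Ring A] {M N P : Type*} [AddCommGroup M] [AddCommGroup N] [AddCommGroup P]
  [Module A M] [Module Aᵐᵒᵖ M] [Module A N] [Module Aᵐᵒᵖ N] [Module A P] [Module Aᵐᵒᵖ P]

theorem ext_fun {f g : BimodHom A M N} (h : ∀ m, f m = g m) : f = g := by
  obtain ⟨f, _, _⟩ := f
  obtain ⟨g, _, _⟩ := g
  obtain rfl : f = g := AddMonoidHom.ext h
  rfl

@[simp] theorem left_apply (f : BimodHom A M N) (m : M) : f.left m = f m := rfl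

@[simp] theorem right_apply (f : BimodHom A M N) (m : M) : f.right m = f m := rfl

/-- Composition of bimodule maps. -/
def comp (g : BimodHom A N P) (f : BimodHom A M N) : BimodHom A M P where
  toAddMonoidHom := g.toAddMonoidHom.comp f.toAddMonoidHom
  map_smul' a m := by
    change g.left (f.left (a • m)) = a • g.left (f.left m)
    rw [map_smul, map_smul]
  map_op_smul' a m := by
    change g.right (f.right (a • m)) = a • g.right (f.right m)
    rw [map_smul, map_smul]

instance : Zero (BimodHom A M A) := ⟨⟨0, by simp, by simp⟩⟩

instance : Add (BimodHom A M A) := ⟨fun f g => ⟨f.toAddMonoidHom + g.toAddMonoidHom,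
  fun a m => by
    change f.left (a • m) + g.left (a • m) = a • (f.left m + g.left m)
    rw [map_smul, map_smul, smul_add],
  fun a m => by
    change f.right (a • m) + g.right (a • m) = a • (f.right m + g.right m)
    rw [map_smul, map_smul, smul_add]⟩⟩

instance : SMul (Subring.center A) (BimodHom A M A) := ⟨fun z f =>
  ⟨(AddMonoidHom.mulLeft (z : A)).comp f.toAddMonoidHom,
  fun a m => by
    change (z : A) * f.left (a • m) = a • ((z : A) * f.left m)
    rw [map_smul, smul_eq_mul, smul_eq_mul, ← mul_assoc, ← mul_assoc,
      Subring.mem_center_iff.1 z.2 a],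
  fun a m => by
    change (z : A) * f.right (a • m) = a • ((z : A) * f.right m)
    rw [map_smul, mul_smul_comm]⟩⟩

instance : Neg (BimodHom A M A) := ⟨fun f => (-1 : Subring.center A) • f⟩

@[simp] theorem zero_apply (m : M) : (0 : BimodHom A M A) m = 0 := rfl

@[simp] theorem add_apply (f g : BimodHom A M A) (m : M) : (f + g) m = f m + g m := rfl

@[simp] theorem center_smul_apply (z : Subring.center A) (f : BimodHom A M A) (m : M) :
    (z • f) m = z * f m := rfl

@[simp] theorem neg_apply (f : BimodHom A M A) (m : M) : (-f) m = - f m :=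
  (congrArg (· * f m) (by simp : ((-1 : Subring.center A) : A) = -1)).trans (neg_one_mul _)

instance : AddCommGroup (BimodHom A M A) where
  add_assoc f g h := ext_fun fun m => add_assoc _ _ _
  zero_add f := ext_fun fun m => zero_add _
  add_zero f := ext_fun fun m => add_zero _
  add_comm f g := ext_fun fun m => add_comm _ _
  neg_add_cancel f := ext_fun fun m => by simp
  nsmul := nsmulRec
  zsmul := zsmulRec

instance : Module (Subring.center A) (BimodHom A M A) where
  one_smul f := ext_fun fun m => by simp
  mul_smul z z' f := ext_fun fun m => by simp [mul_assoc]
  smul_zero z := ext_fun fun m => by simp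
  smul_add z f g := ext_fun fun m => by simp [mul_add]
  add_smul z z' f := ext_fun fun m => by simp [add_mul]
  zero_smul f := ext_fun fun m => by simp

/-- Evaluation of bimodule functionals at `m`. -/
def evalHom (m : M) : BimodHom A M A →+ A := AddMonoidHom.mk' (fun f => f m) fun _ _ => rfl

@[simp] theorem sum_apply {ι : Type*} (t : Finset ι) (f : ι → BimodHom A M A) (m : M) :
    (∑ i ∈ t, f i) m = ∑ i ∈ t, f i m := map_sum (evalHom m) f t

/-- a f(m) = f(am) = f(ma) = f(m) a. This is why scalars over the center of A appear. -/
theorem apply_mem_center (f : BimodHom A M A) {m : M} (hm : ∀ a : A, a • m = op a • m) :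
    f m ∈ Subring.center A := by
  refine Subring.mem_center_iff.2 fun a => ?_
  have h1 : f.left (a • m) = a * f m := map_smul f.left a m
  have h2 : f.right (op a • m) = f m * a := map_smul f.right (op a) m
  rw [← h1, ← h2, hm]
  rfl

/-- Evaluation of bimodule functionals at an element that commutes with `A`. -/
def evalCenter (m : M) (hm : ∀ a : A, a • m = op a • m) :
    BimodHom A M A →ₗ[Subring.center A] Subring.center A where
  toFun f := ⟨f m, f.apply_mem_center hm⟩
  map_add' _ _ := rfl
  map_smul' _ _ := rfl

@[simp] theorem coe_evalCenter (m : M) (hm : ∀ a : A, a • m = op a • m) (f : BimodHom A M A) :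
    (evalCenter m hm f : A) = f m := rfl

end BimodHom

/-! ### Products of functionals on a tensor product -/

namespace Tens

variable {A : Type*} [Ring A]

section

variable {M N : Type*} [AddCommGroup M] [AddCommGroup N] [Module Aᵐᵒᵖ M] [Module A N]

/-- The map `m ⊗ n ↦ f m * g n`. -/
def mulForm (f : M →ₗ[Aᵐᵒᵖ] A) (g : N →ₗ[A] A) : Tens A M N →+ A := lid.comp (map f g)

@[simp] theorem mulForm_tmul (f : M →ₗ[Aᵐᵒᵖ] A) (g : N →ₗ[A] A) (m : M) (n : N) :
    mulForm f g (tmul A m n) = f m * g n := rfl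

theorem mulForm_map {M' N' : Type*} [AddCommGroup M'] [AddCommGroup N'] [Module Aᵐᵒᵖ M']
    [Module A N'] (f : M →ₗ[Aᵐᵒᵖ] A) (g : N →ₗ[A] A) (f' : M' →ₗ[Aᵐᵒᵖ] M) (g' : N' →ₗ[A] N)
    (x : Tens A M' N') : mulForm f g (map f' g' x) = mulForm (f ∘ₗ f') (g ∘ₗ g') x := by
  change lid (map f g (map f' g' x)) = _
  rw [map_map]
  rfl

end

variable {M N : Type*} [AddCommGroup M] [AddCommGroup N] [Module A M] [Module Aᵐᵒᵖ M]
  [SMulCommClass A Aᵐᵒᵖ M] [Module A N] [Module Aᵐᵒᵖ N] [SMulCommClass A Aᵐᵒᵖ N]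

/-- The bimodule functional `m ⊗ n ↦ f m * g n`. -/
def mulBimodHom (f : BimodHom A M A) (g : BimodHom A N A) : BimodHom A (Tens A M N) A where
  toAddMonoidHom := mulForm f.right g.left
  map_smul' a x := by
    change mulForm f.right g.left (a • x) = a • mulForm f.right g.left x
    induction x using Tens.induction with
    | tmul m n =>
      rw [smul_tmul, mulForm_tmul, mulForm_tmul, smul_eq_mul, ← mul_assoc]
      exact congrArg (· * g n) (map_smul f.left a m)
    | add x y hx hy => rw [smul_add, map_add, map_add, smul_add, hx, hy]
  map_op_smul' a x := by
    change mulForm f.right g.left (a • x) = a • mulForm f.right g.left x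
    induction x using Tens.induction with
    | tmul m n =>
      rw [op_smul_tmul', mulForm_tmul, mulForm_tmul, ← mul_smul_comm]
      exact congrArg (f m * ·) (map_smul g.right a n)
    | add x y hx hy => rw [smul_add, map_add, map_add, smul_add, hx, hy]

theorem mulBimodHom_apply (f : BimodHom A M A) (g : BimodHom A N A) (x : Tens A M N) :
    mulBimodHom f g x = mulForm f.right g.left x := rfl

@[simp] theorem mulBimodHom_tmul (f : BimodHom A M A) (g : BimodHom A N A) (m : M) (n : N) :
    mulBimodHom f g (tmul A m n) = f m * g n := rfl

theorem bimodHom_ext {f g : BimodHom A (Tens A M N) A}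
    (h : ∀ m n, f (tmul A m n) = g (tmul A m n)) : f = g := by
  have : f.toAddMonoidHom = g.toAddMonoidHom := hom_ext h
  exact BimodHom.ext_fun fun x => DFunLike.congr_fun this x

theorem mulBimodHom_assoc {P : Type*} [AddCommGroup P] [Module A P] [Module Aᵐᵒᵖ P]
    [SMulCommClass A Aᵐᵒᵖ P] (f : BimodHom A M A) (g : BimodHom A N A) (h : BimodHom A P A)
    (x : Tens A (Tens A M N) P) :
    mulBimodHom f (mulBimodHom g h) (assoc x) = mulBimodHom (mulBimodHom f g) h x := by
  change ((mulBimodHom f (mulBimodHom g h)).toAddMonoidHom.comp assoc.toAddMonoidHom) x =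
    (mulBimodHom (mulBimodHom f g) h).toAddMonoidHom x
  refine DFunLike.congr_fun (hom_ext fun y p => ?_) x
  change mulBimodHom f (mulBimodHom g h) (assoc (tmul A y p)) = mulBimodHom f g y * h p
  induction y using Tens.induction with
  | tmul m n => simp [mul_assoc]
  | add y z hy hz =>
    rw [add_tmul, map_add]
    change (mulBimodHom f (mulBimodHom g h)).left _ = (mulBimodHom f g).left _ * _
    rw [map_add, map_add, add_mul]
    exact congrArg₂ _ hy hz

end Tens

/-! ### The convolution algebra and its tensor square -/

section Convolution

variable {A C : Type*} [Ring A] [AddCommGroup C] [Module A C] [Module Aᵐᵒᵖ C]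
  [SMulCommClass A Aᵐᵒᵖ C]

namespace Convolution

/-- Left linearity of f gives f(g(c) d) = g(c) f(d). It yields the left unit law and lets
functionals be applied to the Casimir identity. -/
theorem apply_lid_map {N : Type*} [AddCommGroup N] [Module A N] [Module Aᵐᵒᵖ N]
    [SMulCommClass A Aᵐᵒᵖ N] (f : BimodHom A C A) (g : BimodHom A N A) (x : Tens A N C) :
    f (Tens.lid (Tens.map g.right LinearMap.id x)) = Tens.mulBimodHom g f x := by
  induction x using Tens.induction with
  | tmul c d => exact map_smul f.left (g c) d
  | add x y hx hy =>
    change f.left _ = (Tens.mulBimodHom g f).left _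
    rw [map_add, map_add, map_add, map_add]
    exact congrArg₂ _ hx hy

theorem apply_rid_map {N : Type*} [AddCommGroup N] [Module A N] [Module Aᵐᵒᵖ N]
    [SMulCommClass A Aᵐᵒᵖ N] (f : BimodHom A C A) (g : BimodHom A N A) (x : Tens A C N) :
    f (Tens.rid (Tens.map LinearMap.id g.left x)) = Tens.mulBimodHom f g x := by
  induction x using Tens.induction with
  | tmul c d => exact map_smul f.right (op (g d)) c
  | add x y hx hy =>
    change f.left _ = (Tens.mulBimodHom f g).left _
    rw [map_add, map_add, map_add, map_add]
    exact congrArg₂ _ hx hy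

theorem mulBimodHom_add_left (f g h : BimodHom A C A) :
    Tens.mulBimodHom (f + g) h = Tens.mulBimodHom f h + Tens.mulBimodHom g h :=
  Tens.bimodHom_ext fun _ _ => add_mul _ _ _

theorem mulBimodHom_add_right (f g h : BimodHom A C A) :
    Tens.mulBimodHom f (g + h) = Tens.mulBimodHom f g + Tens.mulBimodHom f h :=
  Tens.bimodHom_ext fun _ _ => mul_add _ _ _

theorem mulBimodHom_smul_left (z : Subring.center A) (f g : BimodHom A C A) :
    Tens.mulBimodHom (z • f) g = z • Tens.mulBimodHom f g :=
  Tens.bimodHom_ext fun _ _ => mul_assoc _ _ _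

theorem mulBimodHom_smul_right (z : Subring.center A) (f g : BimodHom A C A) :
    Tens.mulBimodHom f (z • g) = z • Tens.mulBimodHom f g :=
  Tens.bimodHom_ext fun c d => by
    simp only [Tens.mulBimodHom_tmul, BimodHom.center_smul_apply, ← mul_assoc,
      Subring.mem_center_iff.1 z.2 (f c)]

end Convolution

variable [Coring A C]

instance : One (BimodHom A C A) := ⟨Coring.counit⟩

instance : Mul (BimodHom A C A) := ⟨fun f g => (Tens.mulBimodHom f g).comp Coring.comul⟩

namespace Convolution

theorem one_apply (c : C) : (1 : BimodHom A C A) c = Coring.counit (A := A) c := rfl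

theorem mul_apply (f g : BimodHom A C A) (c : C) : (f * g) c = Tens.mulBimodHom f g (Coring.comul (A := A) c) := rfl

theorem one_mul' (f : BimodHom A C A) : 1 * f = f := BimodHom.ext_fun fun c => by
  rw [mul_apply, ← apply_lid_map]
  exact congrArg f (Coring.counit_left c)

theorem mul_one' (f : BimodHom A C A) : f * 1 = f := BimodHom.ext_fun fun c => by
  rw [mul_apply, ← apply_rid_map]
  exact congrArg f (Coring.counit_right c)

theorem mul_assoc' (f g h : BimodHom A C A) : f * g * h = f * (g * h) :=
  BimodHom.ext_fun fun c => by
    have h1 (x : Tens A C C) : Tens.mulBimodHom (f * g) h x =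
        Tens.mulBimodHom (Tens.mulBimodHom f g) h (Tens.map (Coring.comul (A := A) (C := C)).right LinearMap.id x) := by
      rw [Tens.mulBimodHom_apply, Tens.mulBimodHom_apply, Tens.mulForm_map]
      rfl
    have h2 (x : Tens A C C) : Tens.mulBimodHom f (g * h) x =
        Tens.mulBimodHom f (Tens.mulBimodHom g h) (Tens.map LinearMap.id (Coring.comul (A := A) (C := C)).left x) := by
      rw [Tens.mulBimodHom_apply, Tens.mulBimodHom_apply, Tens.mulForm_map]
      rfl
    rw [mul_apply, mul_apply, h1, h2, ← Coring.coassoc, Tens.mulBimodHom_assoc]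

instance : Ring (BimodHom A C A) where
  left_distrib f g h := BimodHom.ext_fun fun c => by
    rw [mul_apply, mulBimodHom_add_right]; rfl
  right_distrib f g h := BimodHom.ext_fun fun c => by
    rw [mul_apply, mulBimodHom_add_left]; rfl
  zero_mul f := BimodHom.ext_fun fun c => by
    have : Tens.mulBimodHom 0 f = (0 : BimodHom A (Tens A C C) A) :=
      Tens.bimodHom_ext fun c d => zero_mul _
    rw [mul_apply, this]; rfl
  mul_zero f := BimodHom.ext_fun fun c => by
    have : Tens.mulBimodHom f 0 = (0 : BimodHom A (Tens A C C) A) :=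
      Tens.bimodHom_ext fun c d => mul_zero _
    rw [mul_apply, this]; rfl
  mul_assoc := mul_assoc'
  one_mul := one_mul'
  mul_one := mul_one'
  neg_add_cancel := neg_add_cancel
  zsmul := zsmulRec

instance : Algebra (Subring.center A) (BimodHom A C A) := Algebra.ofModule
  (fun z f g => BimodHom.ext_fun fun c => by rw [mul_apply, mulBimodHom_smul_left]; rfl)
  (fun z f g => BimodHom.ext_fun fun c => by rw [mul_apply, mulBimodHom_smul_right]; rfl)

open TensorProduct in
/-- The bimodule functional on `C ⊗ C` defined by a tensor of functionals on `C`. -/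
noncomputable def tensorForm : BimodHom A C A ⊗[Subring.center A] BimodHom A C A
    →ₗ[Subring.center A] BimodHom A (Tens A C C) A :=
  TensorProduct.lift (LinearMap.mk₂ (Subring.center A) (fun f g => Tens.mulBimodHom f g)
    mulBimodHom_add_left mulBimodHom_smul_left mulBimodHom_add_right
    (fun z f g => mulBimodHom_smul_right z f g))

open TensorProduct

@[simp] theorem tensorForm_tmul (f g : BimodHom A C A) :
    tensorForm (f ⊗ₜ[Subring.center A] g) = Tens.mulBimodHom f g := rfl

theorem mul'_apply (w : BimodHom A C A ⊗[Subring.center A] BimodHom A C A) (c : C) :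
    (LinearMap.mul' (Subring.center A) (BimodHom A C A) w) c = tensorForm w (Coring.comul (A := A) c) := by
  induction w with
  | zero => simp
  | tmul f g => rfl
  | add x y hx hy => rw [map_add, map_add, BimodHom.add_apply, BimodHom.add_apply, hx, hy]

/-- Left multiplication on the first factor is dual to Δ ⊗ C, as right multiplication on the second
is to C ⊗ Δ. Thus the Casimir relation in the tensor square translates into the Casimir relation for
functionals on C ⊗_A C. -/
theorem tensorForm_rTensor (f : BimodHom A C A)
    (w : BimodHom A C A ⊗[Subring.center A] BimodHom A C A) (x : Tens A C C) :
    tensorForm ((LinearMap.mulLeft (Subring.center A) f).rTensor _ w) x =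
      Tens.mulBimodHom f (tensorForm w) (Tens.assoc (Tens.map (Coring.comul (A := A) (C := C)).right LinearMap.id x)) := by
  induction w with
  | zero =>
    have : Tens.mulBimodHom f 0 = (0 : BimodHom A (Tens A C (Tens A C C)) A) :=
      Tens.bimodHom_ext fun c d => mul_zero _
    simp [this]
  | tmul g h =>
    rw [LinearMap.rTensor_tmul, tensorForm_tmul, tensorForm_tmul, Tens.mulBimodHom_assoc,
      Tens.mulBimodHom_apply, Tens.mulBimodHom_apply, Tens.mulForm_map]
    rfl
  | add v w hv hw =>
    have : Tens.mulBimodHom f (tensorForm v + tensorForm w) =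
        Tens.mulBimodHom f (tensorForm v) + Tens.mulBimodHom f (tensorForm w) :=
      Tens.bimodHom_ext fun c d => mul_add _ _ _
    rw [map_add, map_add, map_add, this, BimodHom.add_apply, BimodHom.add_apply, hv, hw]

theorem tensorForm_lTensor (f : BimodHom A C A)
    (w : BimodHom A C A ⊗[Subring.center A] BimodHom A C A) (x : Tens A C C) :
    tensorForm ((LinearMap.mulRight (Subring.center A) f).lTensor _ w) x =
      Tens.mulBimodHom (tensorForm w) f (Tens.assoc.symm (Tens.map LinearMap.id (Coring.comul (A := A) (C := C)).left x)) := by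
  induction w with
  | zero =>
    have : Tens.mulBimodHom 0 f = (0 : BimodHom A (Tens A (Tens A C C) C) A) :=
      Tens.bimodHom_ext fun c d => zero_mul _
    simp [this]
  | tmul g h =>
    rw [LinearMap.lTensor_tmul, tensorForm_tmul, tensorForm_tmul, ← Tens.mulBimodHom_assoc,
      AddEquiv.apply_symm_apply, Tens.mulBimodHom_apply, Tens.mulBimodHom_apply, Tens.mulForm_map]
    rfl
  | add v w hv hw =>
    have : Tens.mulBimodHom (tensorForm v + tensorForm w) f =
        Tens.mulBimodHom (tensorForm v) f + Tens.mulBimodHom (tensorForm w) f :=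
      Tens.bimodHom_ext fun c d => add_mul _ _ _
    rw [map_add, map_add, map_add, this, BimodHom.add_apply, BimodHom.add_apply, hv, hw]

end Convolution

end Convolution

end CoringTheory
namespace CoringTheory

/-! ### Frobenius systems of coseparable centrally projective corings -/

section Frobenius

open TensorProduct CoringTheory.Convolution

/-- A centrally projective bimodule has a finite dual basis consisting of bimodule functionals and
of elements that commute with `A`. -/
theorem IsCentrallyProjective.exists_basis {A C : Type u} [Ring A] [AddCommGroup C] [Module A C]
    [Module Aᵐᵒᵖ C] [SMulCommClass A Aᵐᵒᵖ C] (h : IsCentrallyProjective A C) :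
    ∃ (n : ℕ) (F : Fin n → BimodHom A C A) (z : Fin n → C),
      (∀ i (a : A), a • z i = op a • z i) ∧ ∀ c, ∑ i, F i c • z i = c := by
  obtain ⟨n, W, _, _, _, _, f, hinj, hsurj⟩ := h
  -- The preimages of the standard basis vectors of Aⁿ commute with A because those vectors do and
  -- `f` is injective.
  choose g hg using fun i : Fin n => hsurj (Pi.single i 1)
  let F (i : Fin n) : BimodHom A C A :=
    { toFun := fun c => f (c, 0) i
      map_zero' := by
        change f.left (0 : C × W) i = 0
        rw [map_zero]; rfl
      map_add' := fun c d => by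
        change f.left (c + d, 0) i = f.left (c, 0) i + f.left (d, 0) i
        rw [← Pi.add_apply, ← map_add, Prod.mk_add_mk, add_zero]
      map_smul' := fun a c => by
        change f.left (a • c, 0) i = a • f.left (c, 0) i
        rw [← Pi.smul_apply, ← map_smul, Prod.smul_mk, smul_zero]
      map_op_smul' := fun a c => by
        change f.right (a • c, 0) i = a • f.right (c, 0) i
        rw [← Pi.smul_apply, ← map_smul, Prod.smul_mk, smul_zero] }
  refine ⟨n, F, fun i => (g i).1, fun i a => ?_, fun c => ?_⟩
  · have : a • g i = op a • g i := hinj <| by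
      change f.left (a • g i) = f.right (op a • g i)
      rw [map_smul, map_smul]
      change a • f (g i) = op a • f (g i)
      rw [hg]
      ext j
      by_cases hj : j = i
      · subst hj; simp
      · simp [hj]
    exact congrArg Prod.fst this
  · have : ∑ i, F i c • g i = (c, 0) := hinj <| by
      change f.left _ = f (c, 0)
      rw [map_sum]
      ext j
      simp only [map_smul, Finset.sum_apply, Pi.smul_apply]
      rw [Finset.sum_eq_single j]
      · change F j c • f (g j) j = f (c, 0) j
        rw [hg]
        simp [F]
      · intro i _ hij
        change F i c • f (g i) j = 0
        rw [hg]
        simp [hij.symm]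
      · simp
    simpa [Prod.fst_sum] using congrArg Prod.fst this

/-- The data of a reduced Frobenius system of a coring. -/
structure IsFrobeniusSystem {A C : Type*} [Ring A] [AddCommGroup C] [Module A C] [Module Aᵐᵒᵖ C]
    [SMulCommClass A Aᵐᵒᵖ C] [Coring A C] (γ : BimodHom A (Tens A C C) A) (z : C) : Prop where
  central : ∀ a : A, a • z = op a • z
  left : ∀ c, γ (Tens.tmul A z c) = Coring.counit (A := A) c
  right : ∀ c, γ (Tens.tmul A c z) = Coring.counit (A := A) c
  casimir : ∀ x : Tens A C C,
    Tens.rid (Tens.map LinearMap.id γ.left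
      (Tens.assoc (Tens.map (Coring.comul (A := A) (C := C)).right LinearMap.id x))) =
    Tens.lid (Tens.map γ.right LinearMap.id
      (Tens.assoc.symm (Tens.map LinearMap.id (Coring.comul (A := A) (C := C)).left x)))

/-! ### From a dual basis to a Frobenius system -/

section Basis

variable {A C : Type u} [Ring A] [AddCommGroup C] [Module A C] [Module Aᵐᵒᵖ C]
  {n : ℕ} {F : Fin n → BimodHom A C A} {z : Fin n → C}
  (hz : ∀ i (a : A), a • z i = op a • z i) (hF : ∀ c, ∑ i, F i c • z i = c)

include hz hF

/-- Since g(c) = Σ F_i(c) g(z_i) with g(z_i) central, the F_i and the evaluations at z_i form a dual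
basis of the convolution algebra over the center. -/
theorem sum_evalCenter_smul (g : BimodHom A C A) :
    ∑ i, BimodHom.evalCenter (z i) (hz i) g • F i = g := BimodHom.ext_fun fun c => by
  rw [BimodHom.sum_apply]
  have : g c = ∑ i, F i c * g (z i) := by
    conv_lhs => rw [← hF c]
    change g.left _ = _
    rw [map_sum]
    exact Finset.sum_congr rfl fun i _ => map_smul g.left _ _
  rw [this]
  refine Finset.sum_congr rfl fun i _ => ?_
  rw [BimodHom.center_smul_apply, BimodHom.coe_evalCenter]
  exact (Subring.mem_center_iff.1 (g.apply_mem_center (hz i)) _).symm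

variable [SMulCommClass A Aᵐᵒᵖ C] [Coring A C]

/-- A tensor is determined by its coordinates along the F_i ⊗ F_j, and these are the values of its
functional at the z_i ⊗ z_j. -/
theorem tensorForm_injective : Function.Injective (tensorForm (A := A) (C := C)) := by
  let E (i : Fin n) := BimodHom.evalCenter (z i) (hz i)
  let co (i j : Fin n) : BimodHom A C A ⊗[Subring.center A] BimodHom A C A
      →ₗ[Subring.center A] Subring.center A := LinearMap.mul' _ _ ∘ₗ TensorProduct.map (E i) (E j)
  have hco (i j) (w) : (co i j w : A) = tensorForm w (Tens.tmul A (z i) (z j)) := by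
    induction w with
    | zero => simp
    | tmul f g => simp [co, E]
    | add v w hv hw => rw [map_add, map_add, Subring.coe_add, hv, hw, BimodHom.add_apply]
  have hw (w) : w = ∑ i, ∑ j, co i j w • (F i ⊗ₜ[Subring.center A] F j) := by
    induction w with
    | zero => simp
    | tmul f g =>
      conv_lhs => rw [← sum_evalCenter_smul hz hF f, ← sum_evalCenter_smul hz hF g]
      simp only [TensorProduct.sum_tmul, TensorProduct.tmul_sum, TensorProduct.smul_tmul_smul]
      rw [Finset.sum_comm]
      rfl
    | add v w hv hw =>
      conv_lhs => rw [hv, hw]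
      simp only [map_add, add_smul, Finset.sum_add_distrib]
  intro v w h
  rw [hw v, hw w]
  refine Finset.sum_congr rfl fun i _ => Finset.sum_congr rfl fun j _ => ?_
  congr 1
  exact Subtype.ext (by rw [hco, hco, h])

/-- The z_i ⊗ z_j generate C ⊗_A C and commute with A, so a functional is determined by its values
there, and these are central and can serve as coefficients. -/
theorem tensorForm_surjective : Function.Surjective (tensorForm (A := A) (C := C)) := by
  intro γ
  have hzz (i j : Fin n) (a : A) : a • Tens.tmul A (z i) (z j) = op a • Tens.tmul A (z i) (z j) := by
    rw [Tens.smul_tmul, hz, Tens.op_smul_tmul, hz, Tens.op_smul_tmul']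
  refine ⟨∑ i, ∑ j, BimodHom.evalCenter _ (hzz i j) γ • (F i ⊗ₜ[Subring.center A] F j),
    Tens.bimodHom_ext fun c d => ?_⟩
  have : Tens.tmul A c d = ∑ i, ∑ j, (F i c * F j d) • Tens.tmul A (z i) (z j) := by
    let T₁ : C →+ Tens A C C := AddMonoidHom.mk' (fun x => Tens.tmul A x d)
      fun x y => Tens.add_tmul x y d
    let T₂ (c : C) : C →+ Tens A C C := AddMonoidHom.mk' (fun x => Tens.tmul A c x)
      fun x y => Tens.tmul_add c x y
    have h1 : Tens.tmul A c d = ∑ i, Tens.tmul A (F i c • z i) d := by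
      conv_lhs => rw [← hF c]
      exact map_sum T₁ _ _
    have h2 (i) : Tens.tmul A (F i c • z i) d =
        ∑ j, Tens.tmul A (F i c • z i) (F j d • z j) := by
      conv_lhs => rw [← hF d]
      exact map_sum (T₂ _) _ _
    rw [h1]
    refine Finset.sum_congr rfl fun i _ => (h2 i).trans (Finset.sum_congr rfl fun j _ => ?_)
    rw [← Tens.op_smul_tmul, ← smul_comm (F i c) (op (F j d)) (z i), ← hz, mul_smul,
      Tens.smul_tmul, Tens.smul_tmul]
  have h3 : γ (Tens.tmul A c d) = ∑ i, ∑ j, (F i c * F j d) * γ (Tens.tmul A (z i) (z j)) := by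
    rw [this]
    change γ.left _ = _
    simp only [map_sum, map_smul]
    rfl
  rw [h3]
  simp only [map_sum, map_smul, tensorForm_tmul, BimodHom.sum_apply, BimodHom.center_smul_apply,
    Tens.mulBimodHom_tmul, BimodHom.coe_evalCenter]
  refine Finset.sum_congr rfl fun i _ => Finset.sum_congr rfl fun j _ => ?_
  exact (Subring.mem_center_iff.1 (γ.apply_mem_center (hzz i j)) _).symm

/-- The idempotent is the tensor of ε ∘ π. The relation π ∘ Δ = id makes its product the unit ε, and
by bicolinearity both sides of the Casimir relation become f ∘ π. -/
theorem IsCoseparable.isSeparableAlgebra (h : IsCoseparable A C) :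
    IsSeparableAlgebra (Subring.center A) (BimodHom A C A) := by
  obtain ⟨π, hπ, hr, hl⟩ := h
  obtain ⟨e, he⟩ := tensorForm_surjective hz hF ((1 : BimodHom A C A).comp π)
  refine ⟨e, BimodHom.ext_fun fun c => ?_, fun f => tensorForm_injective hz hF
    (BimodHom.ext_fun fun x => ?_)⟩
  · rw [mul'_apply, he]
    exact congrArg (1 : BimodHom A C A) (hπ c)
  · rw [tensorForm_rTensor, tensorForm_lTensor, he]
    have h1 (x) : Tens.mulBimodHom f ((1 : BimodHom A C A).comp π) x =
        Tens.mulBimodHom f 1 (Tens.map LinearMap.id π.left x) := by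
      rw [Tens.mulBimodHom_apply, Tens.mulBimodHom_apply, Tens.mulForm_map]
      rfl
    have h2 (x) : Tens.mulBimodHom ((1 : BimodHom A C A).comp π) f x =
        Tens.mulBimodHom 1 f (Tens.map π.right LinearMap.id x) := by
      rw [Tens.mulBimodHom_apply, Tens.mulBimodHom_apply, Tens.mulForm_map]
      rfl
    rw [h1, h2, ← hl, ← hr, ← mul_apply, ← mul_apply, mul_one, one_mul]

/-- The Casimir element Σ F_i ⊗ q_i of a symmetric nondegenerate form t supplies γ, and the element
of C representing t supplies the central element. -/
theorem exists_isFrobeniusSystem (h : IsCoseparable A C) :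
    ∃ (γ : BimodHom A (Tens A C C) A) (x : C), IsFrobeniusSystem γ x := by
  let E (i : Fin n) := BimodHom.evalCenter (z i) (hz i)
  have hE (x : BimodHom A C A) : ∑ i, E i x • F i = x := sum_evalCenter_smul hz hF x
  obtain ⟨t, ht, hnd⟩ := (h.isSeparableAlgebra hz hF).exists_symmetric_nondegenerate
    (sum_evalCenter_smul hz hF)
  choose q hq using fun i => hnd (E i)
  have h1 (x : BimodHom A C A) : ∑ i, t (q i * x) • F i = x := by
    simp only [hq, hE]
  -- Symmetry of t makes the q_i and F_i dual bases in the opposite order too; nondegeneracy enters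
  -- through `h1`.
  have h2 (x : BimodHom A C A) : ∑ i, t (x * F i) • q i = x := by
    rw [← sub_eq_zero, ← h1 (_ - x)]
    refine Finset.sum_eq_zero fun j _ => ?_
    have : t (q j * (∑ i, t (x * F i) • q i - x)) = 0 := by
      rw [ht, sub_mul, map_sub, Finset.sum_mul, map_sum, sub_eq_zero]
      simp only [smul_mul_assoc, map_smul, hq]
      conv_rhs => rw [← hE (q j), Finset.mul_sum, map_sum]
      exact Finset.sum_congr rfl fun i _ => by
        rw [mul_smul_comm, map_smul, smul_eq_mul, smul_eq_mul, mul_comm]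
    rw [this, zero_smul]
  -- Chosen so that evaluation at x₀ is t.
  let x₀ : C := ∑ i, (t (F i) : A) • z i
  have hx₀ (f : BimodHom A C A) : f x₀ = t f := by
    change f.left x₀ = _
    rw [map_sum]
    conv_rhs => rw [← hE f, map_sum]
    simp only [map_smul, smul_eq_mul]
    rw [← Subring.subtype_apply, map_sum]
    refine Finset.sum_congr rfl fun i _ => ?_
    rw [map_mul]
    exact (Subring.mem_center_iff.1 (t (F i)).2 _).symm
  let w : BimodHom A C A ⊗[Subring.center A] BimodHom A C A := ∑ i, F i ⊗ₜ q i
  have hw (f : BimodHom A C A) : (LinearMap.mulLeft (Subring.center A) f).rTensor _ w =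
      (LinearMap.mulRight (Subring.center A) f).lTensor _ w := by
    simp only [w, map_sum, LinearMap.rTensor_tmul, LinearMap.lTensor_tmul,
      LinearMap.mulLeft_apply, LinearMap.mulRight_apply]
    calc ∑ i, (f * F i) ⊗ₜ[Subring.center A] q i
        = ∑ i, ∑ j, F j ⊗ₜ (t (q j * f * F i) • q i) := by
          refine Finset.sum_congr rfl fun i _ => ?_
          conv_lhs => rw [← h1 (f * F i), TensorProduct.sum_tmul]
          simp only [TensorProduct.smul_tmul, mul_assoc]
      _ = ∑ j, F j ⊗ₜ (q j * f) := by
          rw [Finset.sum_comm]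
          refine Finset.sum_congr rfl fun j _ => ?_
          rw [← TensorProduct.tmul_sum, h2]
  have hγ (c d : C) : tensorForm w (Tens.tmul A c d) = ∑ i, F i c * q i d := by
    simp [w]
  refine ⟨tensorForm w, x₀, fun a => ?_, fun c => ?_, fun c => ?_, fun x => ?_⟩
  · simp only [x₀, Finset.smul_sum]
    refine Finset.sum_congr rfl fun i _ => ?_
    rw [← smul_comm _ (op a), ← hz, smul_smul, smul_smul, Subring.mem_center_iff.1 (t (F i)).2]
  · have := congrArg (BimodHom.evalHom c) (h2 1)
    rw [map_sum] at this
    rw [hγ, ← one_apply]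
    refine Eq.trans (Finset.sum_congr rfl fun i _ => ?_) this
    rw [hx₀, one_mul]; rfl
  · have := congrArg (BimodHom.evalHom c) (h1 1)
    rw [map_sum] at this
    rw [hγ, ← one_apply]
    refine Eq.trans (Finset.sum_congr rfl fun i _ => ?_) this
    rw [hx₀, mul_one, Subring.mem_center_iff.1 (t (q i)).2]; rfl
  · have key (f : BimodHom A C A) : f (Tens.rid (Tens.map LinearMap.id (tensorForm w).left
        (Tens.assoc (Tens.map (Coring.comul (A := A) (C := C)).right LinearMap.id x)))) =
        f (Tens.lid (Tens.map (tensorForm w).right LinearMap.id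
          (Tens.assoc.symm (Tens.map LinearMap.id (Coring.comul (A := A) (C := C)).left x)))) := by
      have h3 := congrArg (fun v => tensorForm v x) (hw f)
      simp only [tensorForm_rTensor, tensorForm_lTensor] at h3
      rw [apply_rid_map, apply_lid_map, h3]
    -- The F_i separate the elements of C, so the Casimir identity in C follows from its images
    -- under all bimodule functionals.
    rw [← hF (Tens.rid _), ← hF (Tens.lid _)]
    simp only [key]

end Basis

end Frobenius

end CoringTheory
namespace CoringTheory

/-! ### The adjunctions between the forgetful functor and the free functor -/

namespace Tens

/-- The map `(m ⊗ n) ⊗ p ↦ m ⊗ (n ⊗ p)` as a right linear map. -/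
def assocLinear (A : Type*) [Ring A] (M N P : Type*) [AddCommGroup M] [AddCommGroup N]
    [AddCommGroup P] [Module Aᵐᵒᵖ M] [Module A N] [Module Aᵐᵒᵖ N] [SMulCommClass A Aᵐᵒᵖ N]
    [Module A P] [Module Aᵐᵒᵖ P] [SMulCommClass A Aᵐᵒᵖ P] :
    Tens A (Tens A M N) P →ₗ[Aᵐᵒᵖ] Tens A M (Tens A N P) :=
  { assoc.toAddMonoidHom with
    map_smul' := fun a x => by
      change assoc (a • x) = a • assoc x
      induction x using Tens.induction with
      | tmul y p =>
        rw [op_smul_tmul']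
        induction y using Tens.induction with
        | tmul m n => rfl
        | add y z hy hz => simp only [add_tmul, map_add, smul_add, hy, hz]
      | add x y hx hy => simp only [map_add, smul_add, hx, hy] }

/-- The right linear map `m ⊗ n ↦ m * g n`. -/
def ridMap {A : Type*} [Ring A] (M : Type*) {N : Type*} [AddCommGroup M] [AddCommGroup N]
    [Module Aᵐᵒᵖ M] [Module A N] [Module Aᵐᵒᵖ N] [SMulCommClass A Aᵐᵒᵖ N] (g : BimodHom A N A) :
    Tens A M N →ₗ[Aᵐᵒᵖ] M :=
  { rid.comp (map LinearMap.id g.left) with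
    map_smul' := fun a x => by
      change rid (map LinearMap.id g.left (a • x)) = a • rid (map LinearMap.id g.left x)
      induction x using Tens.induction with
      | tmul m n =>
        rw [op_smul_tmul', map_tmul, map_tmul, rid_tmul, rid_tmul, smul_smul]
        congr 1
        rw [← unop_inj]
        exact map_smul g.right a n
      | add x y hx hy => simp only [smul_add, map_add, hx, hy] }

section

variable {A : Type*} [Ring A] {M M' N : Type*} [AddCommGroup M] [AddCommGroup M']
  [AddCommGroup N] [Module Aᵐᵒᵖ M] [Module Aᵐᵒᵖ M'] [Module A N] [Module Aᵐᵒᵖ N]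
  [SMulCommClass A Aᵐᵒᵖ N]

@[simp] theorem ridMap_tmul (g : BimodHom A N A) (m : M) (n : N) :
    ridMap M g (tmul A m n) = op (g n) • m := rfl

theorem ridMap_map (g : BimodHom A N A) (f : M →ₗ[Aᵐᵒᵖ] M') (x : Tens A M N) :
    ridMap M' g (map f LinearMap.id x) = f (ridMap M g x) := by
  induction x using Tens.induction with
  | tmul m n => simp
  | add x y hx hy => simp only [map_add, hx, hy]

end

section

variable {A : Type*} [Ring A] {C M : Type*} [AddCommGroup C] [Module A C] [Module Aᵐᵒᵖ C]
  [SMulCommClass A Aᵐᵒᵖ C] [AddCommGroup M] [Module Aᵐᵒᵖ M]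

theorem ridMap_assoc_symm (γ : BimodHom A (Tens A C C) A) (m : M) (w : Tens A C C) (c : C) :
    Tens.ridMap (Tens A M C) γ (Tens.assoc (Tens.tmul A (Tens.assoc.symm (Tens.tmul A m w)) c)) =
      Tens.tmul A m (Tens.rid (Tens.map LinearMap.id γ.left (Tens.assoc (Tens.tmul A w c)))) := by
  induction w using Tens.induction with
  | tmul d d' => simp [Tens.op_smul_tmul']
  | add x y hx hy => simp only [Tens.tmul_add, Tens.add_tmul, map_add, hx, hy]

theorem map_ridMap_assoc_symm (γ : BimodHom A (Tens A C C) A) (m : M) (d : C) (w : Tens A C C) :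
    Tens.map (Tens.ridMap M γ ∘ₗ Tens.assocLinear A M C C) LinearMap.id
        (Tens.assoc.symm (Tens.tmul A (Tens.tmul A m d) w)) =
      Tens.tmul A m (Tens.lid (Tens.map γ.right LinearMap.id
        (Tens.assoc.symm (Tens.tmul A d w)))) := by
  induction w using Tens.induction with
  | tmul c c' =>
    change Tens.tmul A (op (γ (Tens.tmul A d c)) • m) c' =
      Tens.tmul A m (γ (Tens.tmul A d c) • c')
    rw [Tens.op_smul_tmul]
  | add x y hx hy => simp only [Tens.tmul_add, map_add, hx, hy]

end

end Tens

section Adjunctions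

variable (A C : Type u) [Ring A] [AddCommGroup C] [Module A C] [Module Aᵐᵒᵖ C]
  [SMulCommClass A Aᵐᵒᵖ C] [Coring A C]

/-- The free functor is right adjoint to the forgetful functor. -/
def forgetFreeAdjunction : Comod.forget A C ⊣ Comod.free A C := Adjunction.mkOfUnitCounit
  { unit :=
      { app := fun N =>
          { hom := ModuleCat.ofHom N.coact
            colinear := fun m => (AddEquiv.symm_apply_eq _).2 (N.coassoc m).symm }
        naturality := fun M N f => by
          ext m
          exact f.colinear m }
    counit :=
      { app := fun M => ModuleCat.ofHom (Tens.ridMap M (Coring.counit (A := A) (C := C)))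
        naturality := fun M N f => by
          ext x
          exact Tens.ridMap_map (Coring.counit (A := A) (C := C)) f.hom x }
    left_triangle := by
      ext N m
      exact N.counit m
    right_triangle := by
      ext M x
      change Tens.map (Tens.ridMap M (Coring.counit (A := A) (C := C))) LinearMap.id
        (Comod.freeCoact A C M x) = x
      induction x using Tens.induction with
      | tmul m c =>
        rw [Comod.freeCoact_tmul]
        refine Eq.trans ?_ (congrArg (Tens.tmul A m) (Coring.counit_left (A := A) c))
        induction (Coring.comul (A := A) c : Tens A C C) using Tens.induction with
        | tmul c d => simp [Tens.op_smul_tmul]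
        | add x y hx hy => simp only [Tens.tmul_add, map_add, hx, hy]
      | add x y hx hy => simp only [map_add, hx, hy] }

variable {A C}

namespace IsFrobeniusSystem

variable {γ : BimodHom A (Tens A C C) A} {z : C}

/-- The unit `m ↦ m ⊗ z`. -/
def unitMap (h : IsFrobeniusSystem γ z) (M : Type*) [AddCommGroup M] [Module Aᵐᵒᵖ M] :
    M →ₗ[Aᵐᵒᵖ] Tens A M C where
  toFun m := Tens.tmul A m z
  map_add' m m' := Tens.add_tmul m m' z
  map_smul' a m := by
    rw [RingHom.id_apply, Tens.op_smul_tmul']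
    exact (Tens.op_smul_tmul m a.unop z).trans (congrArg _ (h.central _))

/-- The coaction followed by the contraction `n ⊗ c ↦ n₀ γ(n₁ ⊗ c)`. -/
def counitMap (γ : BimodHom A (Tens A C C) A) (N : Comod A C) :
    Tens A N.carrier C →ₗ[Aᵐᵒᵖ] N.carrier :=
  Tens.ridMap N.carrier γ ∘ₗ Tens.assocLinear A N.carrier C C ∘ₗ Tens.rTensor C N.coact

theorem counitMap_tmul (N : Comod A C) (n : N.carrier) (c : C) : counitMap γ N (Tens.tmul A n c) =
    Tens.ridMap N.carrier γ (Tens.assoc (Tens.tmul A (N.coact n) c)) := rfl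

theorem counitMap_naturality {M N : Comod A C} (f : M ⟶ N) (x : Tens A M.carrier C) :
    counitMap γ N (Tens.map f.hom.hom LinearMap.id x) = f.hom.hom (counitMap γ M x) := by
  induction x using Tens.induction with
  | tmul m c =>
    rw [Tens.map_tmul, counitMap_tmul, counitMap_tmul, f.colinear]
    induction M.coact m using Tens.induction with
    | tmul n d => simp
    | add x y hx hy => simp only [Tens.add_tmul, map_add, hx, hy]
  | add x y hx hy => simp only [map_add, hx, hy]

theorem casimir_tmul (h : IsFrobeniusSystem γ z) (c d : C) :
    Tens.rid (Tens.map LinearMap.id γ.left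
      (Tens.assoc (Tens.tmul A (Coring.comul (A := A) c) d))) =
    Tens.lid (Tens.map γ.right LinearMap.id
      (Tens.assoc.symm (Tens.tmul A c (Coring.comul (A := A) d)))) :=
  h.casimir (Tens.tmul A c d)

/-- Coassociativity of N replaces the second coaction by Δ on the coefficient n₁, and the Casimir
identity then moves Δ from n₁ to c. -/
theorem counitMap_colinear (h : IsFrobeniusSystem γ z) (N : Comod A C)
    (x : Tens A N.carrier C) : N.coact (counitMap γ N x) =
      Tens.map (counitMap γ N) LinearMap.id (Comod.freeCoact A C N.carrier x) := by
  induction x using Tens.induction with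
  | tmul n c =>
    have h1 (y : Tens A N.carrier C) :
        N.coact (Tens.ridMap N.carrier γ (Tens.assoc (Tens.tmul A y c))) =
          Tens.ridMap (Tens A N.carrier C) γ (Tens.assoc (Tens.tmul A (Tens.assoc.symm
            (Tens.assoc (Tens.map N.coact (LinearMap.id : C →ₗ[A] C) y))) c)) := by
      rw [AddEquiv.symm_apply_apply]
      induction y using Tens.induction with
      | tmul n d => simp
      | add x y hx hy => simp only [Tens.add_tmul, map_add, hx, hy]
    have h2 (y : Tens A N.carrier C) :
        Tens.ridMap (Tens A N.carrier C) γ (Tens.assoc (Tens.tmul A (Tens.assoc.symm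
            (Tens.map LinearMap.id (Coring.comul (A := A) (C := C)).left y)) c)) =
          Tens.map (Tens.ridMap N.carrier γ ∘ₗ Tens.assocLinear A N.carrier C C) LinearMap.id
            (Tens.assoc.symm (Tens.tmul A y (Coring.comul (A := A) c))) := by
      induction y using Tens.induction with
      | tmul n d =>
        rw [Tens.map_ridMap_assoc_symm, ← h.casimir_tmul, ← Tens.ridMap_assoc_symm]
        rfl
      | add x y hx hy => simp only [Tens.add_tmul, map_add, hx, hy]
    have h3 (w : Tens A C C) : Tens.map (counitMap γ N) LinearMap.id
        (Tens.assoc.symm (Tens.tmul A n w)) =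
        Tens.map (Tens.ridMap N.carrier γ ∘ₗ Tens.assocLinear A N.carrier C C) LinearMap.id
          (Tens.assoc.symm (Tens.tmul A (N.coact n) w)) := by
      induction w using Tens.induction with
      | tmul d d' => rfl
      | add x y hx hy => simp only [Tens.tmul_add, map_add, hx, hy]
    rw [counitMap_tmul, h1, N.coassoc, h2, Comod.freeCoact_tmul, h3]
  | add x y hx hy => simp only [map_add, hx, hy]

/-- For a coring with a Frobenius system, the free functor is left adjoint to the forgetful
functor. -/
def freeForgetAdjunction (h : IsFrobeniusSystem γ z) : Comod.free A C ⊣ Comod.forget A C :=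
  Adjunction.mkOfUnitCounit
  { unit :=
      { app := fun M => ModuleCat.ofHom (h.unitMap M)
        naturality := fun M N f => by
          ext m
          rfl }
    counit :=
      { app := fun N =>
          { hom := ModuleCat.ofHom (counitMap γ N)
            colinear := h.counitMap_colinear N }
        naturality := fun M N f => by
          ext x
          exact counitMap_naturality f x }
    left_triangle := by
      ext M x
      change counitMap γ (Comod.freeObj A C M) (Tens.map (h.unitMap M) LinearMap.id x) = x
      induction x using Tens.induction with
      | tmul m c =>
        change Tens.ridMap (Tens A M C) γ (Tens.assoc (Tens.tmul A (Comod.freeCoact A C M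
          (Tens.tmul A m z)) c)) = Tens.tmul A m c
        -- By the Casimir identity, z₁ γ(z₂ ⊗ c) = γ(z ⊗ c₁) c₂ = ε(c₁) c₂ = c.
        rw [Comod.freeCoact_tmul, Tens.ridMap_assoc_symm, h.casimir_tmul]
        congr 1
        refine Eq.trans ?_ (Coring.counit_left (A := A) c)
        induction (Coring.comul (A := A) c : Tens A C C) using Tens.induction with
        | tmul d d' => simp [h.left]
        | add x y hx hy => simp only [Tens.tmul_add, map_add, hx, hy]
      | add x y hx hy =>
        rw [map_add]
        exact (map_add (counitMap γ (Comod.freeObj A C M)) _ _).trans (congrArg₂ _ hx hy)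
    right_triangle := by
      ext N n
      change Tens.ridMap N.carrier γ (Tens.assoc (Tens.tmul A (N.coact n) z)) = n
      refine Eq.trans ?_ (N.counit n)
      induction N.coact n using Tens.induction with
      | tmul m c => simp [h.right]
      | add x y hx hy => simp only [Tens.add_tmul, map_add, hx, hy] }

end IsFrobeniusSystem

end Adjunctions

end CoringTheory

theorem mainTheorem11 (A C : Type u) [Ring A] [AddCommGroup C] [Module A C] [Module Aᵐᵒᵖ C]
    [SMulCommClass A Aᵐᵒᵖ C] [CoringTheory.Coring A C]
    (hproj : CoringTheory.IsCentrallyProjective A C) (hcosplit : CoringTheory.IsCosplit A C)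
    (hcosep : CoringTheory.IsCoseparable A C) : CoringTheory.IsFrobenius A C := by
  obtain ⟨n, F, z, hz, hF⟩ := hproj.exists_basis
  obtain ⟨γ, x, h⟩ := CoringTheory.exists_isFrobeniusSystem hz hF hcosep
  exact ⟨CoringTheory.Comod.free A C, ⟨h.freeForgetAdjunction⟩,
    ⟨CoringTheory.forgetFreeAdjunction A C⟩⟩
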